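/- Let $f\in\mathbb R[x,y]$ be a polynomial of degree $n$ with homogeneous decomposition $f=\sum_{i=0}^n f_i$, and suppose that $f_n$ has no repeated factors. Let $H_f(x,y,z)$ be the form of degree $2n-4$ which is the homogenization of $\mathrm{Hess} f=f_{xx}f_{yy}-f_{xy}^2$; its zero set in $\mathbb{RP}^2$ is the projective Hessian curve of $f$, and $z=0$ is the line at infinity. Put $F(u,v,\omega)=\sum_{i=0}^n\omega^{n-i}f_i(u,v)$, $A=-uF_{uu}-vF_{uv}$, $B=-uF_{uv}-vF_{vv}$, $S=u^2F_{uu}+2uvF_{uv}+v^2F_{vv}$, and consider on the unit sphere $\mathbb S^2\subset\mathbb R^3$ the quadratic differential form $$Q=\omega^2F_{uu}\,du^2+2\omega^2F_{uv}\,du\,dv+\omega^2F_{vv}\,dv^2+2\omega A\,du\,d\omega+2\omega B\,dv\,d\omega+S\,d\omega^2 ,$$ that is, $\omega^{n+2}$ times the pullback of the second fundamental form $f_{xx}dx^2+2f_{xy}dx\,dy+f_{yy}dy^2$ under $x=u/\omega$, $y=v/\omega$. Let $\mathbb Y_1,\mathbb Y_2$ be the two fields of lines $Q=0$ on the part of $\mathbb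 S^2$ where the discriminant $-\omega^2H_f$ is nonnegative, labelled so that in a positively oriented chart in which $Q=a\,dv^2+2b\,dv\,d\omega+c\,d\omega^2$ the field $\mathbb Y_k$ is given by $\bigl(b+(-1)^k\sqrt{b^2-ac}\bigr)dv+c\,d\omega=0$ (or by the equivalent equation $a\,dv+\bigl(b-(-1)^k\sqrt{b^2-ac}\bigr)d\omega=0$ where the first one degenerates). A point of this part of the sphere is a singular point of $\mathbb Y_k$ if $\mathbb Y_k$ does not determine a line there; it is a singular point at infinity if it also lies on the equator $\omega=0$. Then, for $k=1,2$: (i) if the projective Hessian curve of $f$ has a nonempty transversal intersection with the line at infinity, then the set of singular points at infinity of $\mathbb Y_k$ is finite, $\mathbb Y_k$ has a Poincaré index at each of them, and the sum of these indices lies in $[0,n-2]$; (ii) if the projective Hessian curve of $f$ does not meet the line at infinity, then the set of singular points at infinity of $\mathbb Y_k$ is finite, $\mathbb Y_k$ has a Poincaré index at each of them, and the sum of these indices lies in $[0,n]$. If moreover $f$ has no flat points in the plane, that is, $f_{xx},f_{xy},f_{yy}$ have no common real zero (for example, if the graph of $f$ is generic), then the same assertions hold for the set $\mathrm{Sing}(\mathbb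 Y_k)$ of all singular points of $\mathbb Y_k$ on the sphere: $$0\le\sum_{\xi\in\mathrm{Sing}(\mathbb Y_k)}\mathrm{Ind}_\xi(\mathbb Y_k)\le n-2\ \text{ in case (i)},\qquad 0\le\sum_{\xi\in\mathrm{Sing}(\mathbb Y_k)}\mathrm{Ind}_\xi(\mathbb Y_k)\le n\ \text{ in case (ii)}.$$ -/

import Mathlib

open MvPolynomial

noncomputable section

namespace AsymptoticFields

/-- The Hessian polynomial `f_xx f_yy - f_xy ^ 2`; the variables `x`, `y` are `X 0`, `X 1`. -/
def hess (f : MvPolynomial (Fin 2) ℝ) : MvPolynomial (Fin 2) ℝ :=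
  pderiv 0 (pderiv 0 f) * pderiv 1 (pderiv 1 f) - pderiv 0 (pderiv 1 f) ^ 2

/-- The homogeneous part `f_n` of highest degree `n = deg f`. -/
def topForm (f : MvPolynomial (Fin 2) ℝ) : MvPolynomial (Fin 2) ℝ :=
  homogeneousComponent f.totalDegree f

/-- The homogenization `∑ i ≤ d, X₂ ^ (d - i) g_i (X₀, X₁)`, of degree `d`, of a polynomial `g` of
degree at most `d` with homogeneous decomposition `g = ∑ g_i`. -/
def homogenizeTo (d : ℕ) (g : MvPolynomial (Fin 2) ℝ) : MvPolynomial (Fin 3) ℝ :=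
  ∑ i ∈ Finset.range (d + 1), X 2 ^ (d - i) * rename Fin.castSucc (homogeneousComponent i g)

/-- The form `H_f` of degree `2 n - 4`: the homogenization of the Hessian polynomial. -/
def hessForm (f : MvPolynomial (Fin 2) ℝ) : MvPolynomial (Fin 3) ℝ :=
  homogenizeTo (2 * f.totalDegree - 4) (hess f)

/-- The form `F = ∑ ω ^ (n - i) f_i (u, v)`; the variables `u`, `v`, `ω` are `X 0`, `X 1`, `X 2`. -/
def homForm (f : MvPolynomial (Fin 2) ℝ) : MvPolynomial (Fin 3) ℝ :=
  homogenizeTo f.totalDegree f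

open scoped LinearAlgebra.Projectivization in
/-- The projective Hessian curve, in the real projective plane. -/
def projHessianCurve (f : MvPolynomial (Fin 2) ℝ) : Set (ℙ ℝ (Fin 3 → ℝ)) :=
  {P | eval P.rep (hessForm f) = 0}

open scoped LinearAlgebra.Projectivization in
/-- The line at infinity `z = 0`. -/
def lineAtInfinity : Set (ℙ ℝ (Fin 3 → ℝ)) := {P | P.rep 2 = 0}

/-- At each common point, the projective Hessian curve is nonsingular and its tangent line is not
the line at infinity: the differentials of `H_f` and of `z` are linearly independent. -/
def HessianTransversalAtInfinity (f : MvPolynomial (Fin 2) ℝ) : Prop :=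
  ∀ P ∈ projHessianCurve f ∩ lineAtInfinity,
    LinearIndependent ℝ ![fun i : Fin 3 => eval P.rep (pderiv i (hessForm f)), ![0, 0, 1]]

/-- The second fundamental form `f_xx dx² + 2 f_xy dx dy + f_yy dy²` has no flat point in the
plane: its three coefficients have no common zero. -/
def NoFlatPoints (f : MvPolynomial (Fin 2) ℝ) : Prop :=
  ∀ x : Fin 2 → ℝ, ¬ (eval x (pderiv 0 (pderiv 0 f)) = 0 ∧ eval x (pderiv 0 (pderiv 1 f)) = 0 ∧
    eval x (pderiv 1 (pderiv 1 f)) = 0)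

/-- The unit sphere of Euclidean `ℝ³`. -/
def sphere : Set (Fin 3 → ℝ) := {p | p ⬝ᵥ p = 1}

/-- The equator of the unit sphere. -/
def equator : Set (Fin 3 → ℝ) := {p | p ∈ sphere ∧ p 2 = 0}

/-- The matrix at `p = (u, v, ω)` of the extended quadratic differential form: `ω ^ (n + 2)` times
the pullback of the second fundamental form of `f` under `(u, v, ω) ↦ (u / ω, v / ω)`. -/
def extForm (f : MvPolynomial (Fin 2) ℝ) (p : Fin 3 → ℝ) : Matrix (Fin 3) (Fin 3) ℝ :=
  let u := p 0
  let v := p 1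
  let ω := p 2
  let Fuu := eval p (pderiv 0 (pderiv 0 (homForm f)))
  let Fuv := eval p (pderiv 0 (pderiv 1 (homForm f)))
  let Fvv := eval p (pderiv 1 (pderiv 1 (homForm f)))
  let A := -u * Fuu - v * Fuv
  let B := -u * Fuv - v * Fvv
  let S := u ^ 2 * Fuu + 2 * u * v * Fuv + v ^ 2 * Fvv
  !![ω ^ 2 * Fuu, ω ^ 2 * Fuv, ω * A;
     ω ^ 2 * Fuv, ω ^ 2 * Fvv, ω * B;
     ω * A, ω * B, S]

/-- The discriminant `-ω² H_f` of the extended form, that is, minus the determinant of its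
restriction to the tangent plane in an orthonormal basis. -/
def disc (f : MvPolynomial (Fin 2) ℝ) (p : Fin 3 → ℝ) : ℝ :=
  -(p 2 ^ 2 * eval p (hessForm f))

/-- The part of the sphere on which the fields are defined. -/
def domain (f : MvPolynomial (Fin 2) ℝ) : Set (Fin 3 → ℝ) := {p | p ∈ sphere ∧ 0 ≤ disc f p}

/-- The `k`-th field of lines (`k = 1, 2`) defined by the extended form `Q`. With `J = p × ·` the
rotation by a right angle of the tangent plane at `p`, oriented by the outward normal, the
endomorphism `J Q` has square `disc`, and its eigenlines for the eigenvalues `± √disc` are the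
null lines of `Q`. In a positively oriented chart in which `Q` is `a dv² + 2 b dv dω + c dω²`,
the `k`-th eigenline is given by `(b + (-1) ^ k √(b² - a c)) dv + c dω = 0`. -/
def lineField (f : MvPolynomial (Fin 2) ℝ) (k : ℕ) (p : Fin 3 → ℝ) :
    Submodule ℝ (Fin 3 → ℝ) where
  carrier := {ξ | p ⬝ᵥ ξ = 0 ∧
    crossProduct p ((extForm f p).mulVec ξ) = ((-1) ^ k * Real.sqrt (disc f p)) • ξ}
  zero_mem' := by simp
  add_mem' := by
    rintro a b ⟨ha, ha'⟩ ⟨hb, hb'⟩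
    exact ⟨by rw [dotProduct_add, ha, hb, add_zero],
      by rw [Matrix.mulVec_add, map_add, ha', hb', smul_add]⟩
  smul_mem' := by
    rintro c a ⟨ha, ha'⟩
    exact ⟨by rw [dotProduct_smul, ha, smul_zero],
      by rw [Matrix.mulVec_smul, map_smul, ha', smul_comm]⟩

/-- The singular points of the `k`-th field: the points of its domain at which it does not
determine a line. -/
def singularPoints (f : MvPolynomial (Fin 2) ℝ) (k : ℕ) : Set (Fin 3 → ℝ) :=
  {p | p ∈ domain f ∧ Module.finrank ℝ (lineField f k p) ≠ 1}

/-- The singular points at infinity: those on the equator. -/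
def singularPointsAtInfinity (f : MvPolynomial (Fin 2) ℝ) (k : ℕ) : Set (Fin 3 → ℝ) :=
  singularPoints f k ∩ equator

/-- The field of lines `L` on the sphere has Poincaré index `i` at `p`. The orthogonal projection
`q ↦ (q · e₁, q · e₂)` to the tangent plane at `p` is used as a chart: along every small circle
around `p` the line `L` is spanned by a vector whose image in the chart has a continuous angle
`θ`, and `θ` increases by `2 π i` when the circle is traversed once. -/
def HasPoincareIndex (L : (Fin 3 → ℝ) → Submodule ℝ (Fin 3 → ℝ)) (p : Fin 3 → ℝ) (i : ℝ) : Prop :=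
  ∃ e₁ e₂ : Fin 3 → ℝ,
    p ⬝ᵥ p = 1 ∧ e₁ ⬝ᵥ e₁ = 1 ∧ e₂ ⬝ᵥ e₂ = 1 ∧ p ⬝ᵥ e₁ = 0 ∧ p ⬝ᵥ e₂ = 0 ∧ e₁ ⬝ᵥ e₂ = 0 ∧
    ∃ R : ℝ, 0 < R ∧ R ≤ 1 ∧ ∀ r : ℝ, 0 < r → r < R →
      ∃ θ : ℝ → ℝ, ContinuousOn θ (Set.Icc 0 (2 * Real.pi)) ∧
        (∀ t ∈ Set.Icc 0 (2 * Real.pi), ∃ ξ : Fin 3 → ℝ,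
          L (Real.sqrt (1 - r ^ 2) • p + (r * Real.cos t) • e₁ + (r * Real.sin t) • e₂) =
              Submodule.span ℝ {ξ} ∧
            ξ ⬝ᵥ e₁ = Real.cos (θ t) ∧ ξ ⬝ᵥ e₂ = Real.sin (θ t)) ∧
        θ (2 * Real.pi) - θ 0 = 2 * Real.pi * i

/-- `s` is finite, `L` has a Poincaré index at each point of `s`, and `a ≤ ∑ ≤ b` for the sum of
these indices. -/
def IndexSumBetween (L : (Fin 3 → ℝ) → Submodule ℝ (Fin 3 → ℝ)) (s : Set (Fin 3 → ℝ))
    (a b : ℝ) : Prop :=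
  s.Finite ∧ ∃ ind : (Fin 3 → ℝ) → ℝ, (∀ p ∈ s, HasPoincareIndex L p (ind p)) ∧
    a ≤ ∑ᶠ p ∈ s, ind p ∧ ∑ᶠ p ∈ s, ind p ≤ b

end AsymptoticFields

end

noncomputable section

namespace AsymptoticFields


/-! On the equator Q reduces to S dω², and S = n(n-1) f_n by Euler's identity, so a singular point
at infinity is a zero of f_n on the unit circle (`eval_topForm_eq_zero_of_singular`). Off the
equator Q degenerates only over flat points (`singularPoints_subset_equator`). It remains to find
the index at each zero c of f_n and to count these zeros.

Index: in the frame (equator, meridian) at c, Q has coefficients ω²A, ωB, S with B² - AS = -s² H_f,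
where s is the radial coordinate. Since f_n is squarefree, its derivative along the circle is
nonzero at c; hence B ≠ 0 and H_f < 0 near c. With K the root of T² - 2BT + AS of larger modulus,
the null directions are (-S/K, ω), which behaves like a node, and (1, -ωA/K), which is regular. As
√disc = |ω| √(-H_f), each field follows the first direction on one side of the equator and the
second on the other. Along a small circle the line turns by π on one half and by 0 on the other, so
every index is 1/2 (`hasPoincareIndex_half`).

Count: a nonzero form of degree n ≥ 1 has at most 2n zeros on the circle, so the sum is at most n.
If the Hessian curve meets the line at infinity, Hess f_n vanishes at some real q ≠ 0. With n
distinct real linear factors, the strict Newton inequality would make Hess f_n(q) negative; with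
exactly n-1, the last factor would be real as well and repeat another one. So at most n-2 factors
are real, and the sum is at most n-2 (`circleZeros_bound_of_hess_eq_zero`). -/

/-! ### Forms, Euler's identity and restriction to lines -/

theorem eval_smul_of_isHomogeneous {σ : Type*} {g : MvPolynomial σ ℝ} {m : ℕ}
    (hg : g.IsHomogeneous m) (c : ℝ) (x : σ → ℝ) : eval (c • x) g = c ^ m * eval x g := by
  rw [eval_eq, eval_eq, Finset.mul_sum]
  refine Finset.sum_congr rfl fun d hd => ?_
  have hdm : ∑ i ∈ d.support, d i = m := (hg.degree_eq_sum_deg_support hd).symm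
  simp only [Pi.smul_apply, smul_eq_mul, mul_pow, Finset.prod_mul_distrib]
  rw [Finset.prod_pow_eq_pow_sum, hdm]
  ring

theorem euler_two {g : MvPolynomial (Fin 2) ℝ} {m : ℕ} (hg : g.IsHomogeneous m)
    (x : Fin 2 → ℝ) :
    x 0 * eval x (pderiv 0 g) + x 1 * eval x (pderiv 1 g) = m * eval x g := by
  have := congrArg (eval x) hg.sum_X_mul_pderiv
  simpa [Fin.sum_univ_two] using this

theorem pderiv_comm {σ : Type*} (i j : σ) (g : MvPolynomial σ ℝ) :
    pderiv i (pderiv j g) = pderiv j (pderiv i g) := by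
  classical
  induction g using MvPolynomial.induction_on with
  | C a => simp
  | add p q hp hq => simp [hp, hq]
  | mul_X p k hp =>
    simp only [pderiv_mul, map_add, hp, pderiv_X, Pi.single_apply]
    split_ifs <;> simp; ring

/-- The restriction of `g` to the parametrized line `t ↦ a + t b`. -/
def restrictLine (g : MvPolynomial (Fin 2) ℝ) (a b : Fin 2 → ℝ) : Polynomial ℝ :=
  aeval (fun i => Polynomial.C (a i) + Polynomial.C (b i) * Polynomial.X) g

theorem eval_restrictLine (g : MvPolynomial (Fin 2) ℝ) (a b : Fin 2 → ℝ) (t : ℝ) :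
    (restrictLine g a b).eval t = eval (a + t • b) g := by
  unfold restrictLine
  induction g using MvPolynomial.induction_on with
  | C a => simp
  | add p q hp hq => simp [hp, hq]
  | mul_X p k hp =>
    rw [map_mul, Polynomial.eval_mul, hp]
    simp [mul_comm t]

theorem derivative_restrictLine (g : MvPolynomial (Fin 2) ℝ) (a b : Fin 2 → ℝ) :
    (restrictLine g a b).derivative =
      Polynomial.C (b 0) * restrictLine (pderiv 0 g) a b +
        Polynomial.C (b 1) * restrictLine (pderiv 1 g) a b := by
  unfold restrictLine
  induction g using MvPolynomial.induction_on with
  | C a => simp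
  | add p q hp hq => simp [hp, hq]; ring
  | mul_X p k hp =>
    fin_cases k <;> simp [hp, pderiv_X] <;> ring

theorem natDegree_restrictLine_le (g : MvPolynomial (Fin 2) ℝ) (a b : Fin 2 → ℝ) :
    (restrictLine g a b).natDegree ≤ g.totalDegree := by
  unfold restrictLine
  rw [aeval_def, eval₂_eq]
  refine Polynomial.natDegree_sum_le_of_forall_le _ _ fun d hd => ?_
  refine (Polynomial.natDegree_C_mul_le _ _).trans ?_
  refine (Polynomial.natDegree_prod_le _ _).trans ?_
  refine le_trans (Finset.sum_le_sum (g := fun i => d i) fun i _ => ?_) (le_totalDegree hd)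
  refine Polynomial.natDegree_pow_le.trans ?_
  have : (Polynomial.C (a i) + Polynomial.C (b i) * Polynomial.X).natDegree ≤ 1 := by
    rw [add_comm]; exact Polynomial.natDegree_linear_le
  nlinarith

/-- `τ ↦ g (τ q + e)`, as the reflection of `τ ↦ g (q + τ e)`. -/
theorem restrictLine_swap {g : MvPolynomial (Fin 2) ℝ} {m : ℕ} (hg : g.IsHomogeneous m)
    (q e : Fin 2 → ℝ) :
    restrictLine g e q = Polynomial.reflect m (restrictLine g q e) := by
  apply Polynomial.eq_of_infinite_eval_eq
  refine Set.Infinite.mono (s := {t : ℝ | t ≠ 0}) ?_ (Set.infinite_of_finite_compl (by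
    have : {t : ℝ | t ≠ 0}ᶜ = {0} := by ext; simp
    rw [this]; exact Set.finite_singleton 0))
  intro t ht
  have ht' : t ≠ 0 := ht
  have hdeg : (restrictLine g q e).natDegree ≤ m :=
    (natDegree_restrictLine_le g q e).trans hg.totalDegree_le
  have h2 : Polynomial.eval t (Polynomial.reflect m (restrictLine g q e)) =
      t ^ m * eval (q + t⁻¹ • e) g := by
    let _ : Invertible t⁻¹ := ⟨t, mul_inv_cancel₀ ht', inv_mul_cancel₀ ht'⟩
    have h1 : Polynomial.eval t (Polynomial.reflect m (restrictLine g q e)) * t⁻¹ ^ m =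
        Polynomial.eval t⁻¹ (restrictLine g q e) :=
      Polynomial.eval₂_reflect_mul_pow (RingHom.id ℝ) t⁻¹ m _ hdeg
    rw [← eval_restrictLine, ← h1, inv_pow]
    field_simp
  show Polynomial.eval t _ = Polynomial.eval t _
  rw [h2, ← eval_smul_of_isHomogeneous hg, eval_restrictLine]
  congr 2
  rw [smul_add, smul_inv_smul₀ ht', add_comm]


/-! ### Real-rooted polynomials in one variable -/

/-- A real polynomial of degree at most `m + 2` with `m + 2` distinct roots satisfies the strict
Newton inequality between its three leading coefficients. -/
theorem newton_lt_of_card_roots {m : ℕ} {G : Polynomial ℝ} (hdeg : G.natDegree ≤ m + 2)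
    (hlead : G.coeff (m + 2) ≠ 0) (hcard : m + 2 ≤ G.roots.toFinset.card) :
    2 * (m + 2) * (G.coeff (m + 2) * G.coeff m) < (m + 1) * G.coeff (m + 1) ^ 2 := by
  -- Rolle: each differentiation loses at most one distinct root.
  have hiter : ∀ j : ℕ, j ≤ m →
      m + 2 ≤ (Polynomial.derivative^[j] G).roots.toFinset.card + j := by
    intro j
    induction j with
    | zero => intro _; simpa using hcard
    | succ j ih =>
      intro hj
      have := Polynomial.card_roots_toFinset_le_derivative (Polynomial.derivative^[j] G)
      have := ih (by omega)
      rw [Function.iterate_succ_apply']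
      omega
  -- The `m`-th derivative is a quadratic whose coefficients are multiples of the three leading ones
  -- of `G`. Two distinct roots make its discriminant positive, and this is the claim up to a common
  -- positive factor.
  have h2 : 1 < (Polynomial.derivative^[m] G).roots.toFinset.card := by
    have := hiter m le_rfl; omega
  obtain ⟨a, ha, b, hb, hab⟩ := Finset.one_lt_card.1 h2
  set P := Polynomial.derivative^[m] G with hP
  have hPdeg : P.natDegree < 3 := by
    have := Polynomial.natDegree_iterate_derivative G m
    rw [← hP] at this
    omega
  have hev : ∀ x, P.eval x = P.coeff 0 + P.coeff 1 * x + P.coeff 2 * x ^ 2 := by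
    intro x
    rw [Polynomial.eval_eq_sum_range' hPdeg]
    simp [Finset.sum_range_succ]
  have ha0 : P.eval a = 0 := by
    rw [Multiset.mem_toFinset] at ha; exact Polynomial.isRoot_of_mem_roots ha
  have hb0 : P.eval b = 0 := by
    rw [Multiset.mem_toFinset] at hb; exact Polynomial.isRoot_of_mem_roots hb
  rw [hev] at ha0 hb0
  have c0 : P.coeff 0 = m.factorial * G.coeff m := by
    rw [hP, Polynomial.coeff_iterate_derivative]
    simp [Nat.descFactorial_self]
  have c1 : P.coeff 1 = (m + 1).factorial * G.coeff (m + 1) := by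
    have h := Nat.factorial_mul_descFactorial (show m ≤ m + 1 by omega)
    rw [hP, Polynomial.coeff_iterate_derivative, ← h, show 1 + m = m + 1 by omega]
    simp
  have c2 : 2 * P.coeff 2 = (m + 2).factorial * G.coeff (m + 2) := by
    have h := Nat.factorial_mul_descFactorial (show m ≤ m + 2 by omega)
    rw [hP, Polynomial.coeff_iterate_derivative, ← h, show 2 + m = m + 2 by omega]
    simp
    ring
  have hm : (0 : ℝ) < m.factorial := by exact_mod_cast m.factorial_pos
  have f1 : ((m + 1).factorial : ℝ) = (m + 1) * m.factorial := by
    rw [Nat.factorial_succ]; push_cast; ring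
  have f2 : ((m + 2).factorial : ℝ) = (m + 2) * ((m + 1) * m.factorial) := by
    rw [Nat.factorial_succ, Nat.factorial_succ]; push_cast; ring
  rw [f1] at c1
  rw [f2] at c2
  have hne : P.coeff 2 ≠ 0 := by
    intro h
    rw [h, mul_zero] at c2
    have : ((m : ℝ) + 2) * ((m + 1) * m.factorial) ≠ 0 := by positivity
    exact (mul_ne_zero this hlead) c2.symm
  have hsum : P.coeff 1 = -(P.coeff 2 * (a + b)) := by
    have : (a - b) * (P.coeff 1 + P.coeff 2 * (a + b)) = 0 := by linear_combination ha0 - hb0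
    rcases mul_eq_zero.1 this with h | h
    · exact absurd (sub_eq_zero.1 h) hab
    · linarith
  have hprod : P.coeff 0 = P.coeff 2 * (a * b) := by rw [hsum] at ha0; linear_combination ha0
  have hdisc : 4 * (P.coeff 2 * P.coeff 0) < P.coeff 1 ^ 2 := by
    have : 0 < (P.coeff 2 * (a - b)) ^ 2 := by
      have := mul_ne_zero hne (sub_ne_zero.2 hab); positivity
    rw [hsum, hprod]; nlinarith
  have h3 : 4 * (P.coeff 2 * P.coeff 0) =
      ((m + 1) * (m.factorial : ℝ) ^ 2) * (2 * (m + 2) * (G.coeff (m + 2) * G.coeff m)) := by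
    rw [c0]; linear_combination (2 * (m.factorial : ℝ) * G.coeff m) * c2
  have h4 : P.coeff 1 ^ 2 =
      ((m + 1) * (m.factorial : ℝ) ^ 2) * ((m + 1) * G.coeff (m + 1) ^ 2) := by
    rw [c1]; ring
  rw [h3, h4] at hdisc
  exact lt_of_mul_lt_mul_left hdisc (by positivity)

/-- A real polynomial of degree `m + 1` with exactly `m` distinct roots has a double root. -/
theorem exists_double_root {m : ℕ} {G : Polynomial ℝ} (hdeg : G.natDegree = m + 1)
    (hcard : G.roots.toFinset.card = m) : ∃ a, G.eval a = 0 ∧ G.derivative.eval a = 0 := by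
  have hG : G ≠ 0 := by rintro rfl; simp at hdeg
  have hm : m ≤ Multiset.card G.roots := by rw [← hcard]; exact G.roots.toFinset_card_le
  obtain ⟨h, hprod, hcardeq, -⟩ := Polynomial.exists_prod_multiset_X_sub_C_mul G
  -- After at least `m` linear factors are split off, the cofactor has degree at most one, so the
  -- last root is real too; `m + 1` roots with `m` distinct values must repeat.
  have hsplit : G.Splits := by
    have hh : h.natDegree ≤ 1 := by omega
    rw [← hprod]
    refine Polynomial.Splits.mul (Polynomial.Splits.multisetProd ?_)
      (Polynomial.Splits.of_natDegree_le_one hh)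
    intro p hp
    obtain ⟨a, -, rfl⟩ := Multiset.mem_map.1 hp
    exact Polynomial.Splits.X_sub_C a
  have hcr := hsplit.natDegree_eq_card_roots
  have hnd : ¬ G.roots.Nodup := by
    intro hn
    rw [Multiset.toFinset_card_of_nodup hn] at hcard
    omega
  rw [Multiset.nodup_iff_count_le_one] at hnd
  push Not at hnd
  obtain ⟨a, ha⟩ := hnd
  rw [Polynomial.count_roots] at ha
  have hroot := (Polynomial.one_lt_rootMultiplicity_iff_isRoot hG).1 ha
  exact ⟨a, hroot.1, hroot.2⟩


/-! ### Squarefree binary forms and their Hessian -/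

/-- The linear form vanishing on the line through `z`. -/
def lineForm (z : Fin 2 → ℝ) : MvPolynomial (Fin 2) ℝ := C (z 1) * X 0 - C (z 0) * X 1

/-- Modulo the linear form, each variable `X i` is congruent to `z i * T`, where `T` is the linear
form ⟨z, X⟩ / |z|². Hence `g` is congruent to its restriction to the line ℝz, evaluated at `T`, and
that restriction is zero. Homogeneity is not needed, so the lemma applies again to the cofactor. -/
theorem lineForm_dvd_of_eval_eq_zero {g : MvPolynomial (Fin 2) ℝ} {z : Fin 2 → ℝ} (hz : z ≠ 0)
    (hg : ∀ s : ℝ, eval (s • z) g = 0) : lineForm z ∣ g := by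
  have hN : z 0 ^ 2 + z 1 ^ 2 ≠ 0 := by
    intro h
    apply hz
    ext i
    fin_cases i
    · show z 0 = 0; nlinarith [sq_nonneg (z 0), sq_nonneg (z 1)]
    · show z 1 = 0; nlinarith [sq_nonneg (z 0), sq_nonneg (z 1)]
  set N := z 0 ^ 2 + z 1 ^ 2 with hNdef
  let T : MvPolynomial (Fin 2) ℝ := C N⁻¹ * (C (z 0) * X 0 + C (z 1) * X 1)
  have hX : ∀ i, lineForm z ∣ X i - C (z i) * T := by
    have hC : (C N⁻¹ : MvPolynomial (Fin 2) ℝ) * (C (z 0) ^ 2 + C (z 1) ^ 2) = 1 := by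
      rw [← C_pow, ← C_pow, ← C_add, ← C_mul, inv_mul_cancel₀ hN, C_1]
    intro i
    fin_cases i
    · refine ⟨C N⁻¹ * C (z 1), ?_⟩
      simp only [T, lineForm, Fin.zero_eta]
      linear_combination -X 0 * hC
    · refine ⟨-(C N⁻¹ * C (z 0)), ?_⟩
      simp only [T, lineForm, Fin.mk_one]
      linear_combination -X 1 * hC
  have key : ∀ h : MvPolynomial (Fin 2) ℝ,
      lineForm z ∣ h - Polynomial.aeval T (restrictLine h 0 z) := by
    intro h
    unfold restrictLine
    induction h using MvPolynomial.induction_on with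
    | C a => simp [Polynomial.aeval_C, algebraMap_eq]
    | add p q hp hq =>
      have := dvd_add hp hq
      simpa [add_sub_add_comm] using this
    | mul_X p k hp =>
      have h1 := (hp.mul_right (X k)).add ((hX k).mul_left (Polynomial.aeval T
        ((aeval fun i => Polynomial.C ((0 : Fin 2 → ℝ) i) + Polynomial.C (z i) * Polynomial.X) p)))
      convert h1 using 1
      simp only [map_mul, aeval_X, map_add, Polynomial.aeval_C, Polynomial.aeval_X, Pi.zero_apply,
        map_zero, algebraMap_eq]
      ring
  have h0 : restrictLine g 0 z = 0 := by
    apply Polynomial.funext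
    intro s
    rw [eval_restrictLine, zero_add, hg, Polynomial.eval_zero]
  simpa [h0] using key g

/-- A squarefree form has nonzero gradient at its nonzero real zeros. -/
theorem gradient_ne_zero_of_squarefree {g : MvPolynomial (Fin 2) ℝ} {m : ℕ}
    (hg : g.IsHomogeneous m) (hsq : Squarefree g) {z : Fin 2 → ℝ} (hz : z ≠ 0)
    (h0 : eval z (pderiv 0 g) = 0) (h1 : eval z (pderiv 1 g) = 0) : eval z g ≠ 0 := by
  intro hgz
  have hvan : ∀ (p : MvPolynomial (Fin 2) ℝ) (d : ℕ), p.IsHomogeneous d → eval z p = 0 →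
      ∀ s : ℝ, s ≠ 0 → eval (s • z) p = 0 := by
    intro p d hp hpz s _
    rw [eval_smul_of_isHomogeneous hp, hpz, mul_zero]
  -- The cofactor `q` below is not known to be homogeneous, so its vanishing at `s = 0` is recovered
  -- from the one-variable restriction, which has infinitely many roots.
  have hcont : ∀ p : MvPolynomial (Fin 2) ℝ, (∀ s : ℝ, s ≠ 0 → eval (s • z) p = 0) →
      ∀ s : ℝ, eval (s • z) p = 0 := by
    intro p hp s
    have : restrictLine p 0 z = 0 := by
      apply Polynomial.eq_zero_of_infinite_isRoot
      refine Set.Infinite.mono (s := Set.Ioi (0 : ℝ)) ?_ (Set.Ioi_infinite 0)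
      intro t ht
      show Polynomial.eval t _ = 0
      rw [eval_restrictLine, zero_add]
      exact hp t (ne_of_gt ht)
    have h := eval_restrictLine p 0 z s
    rw [this, zero_add, Polynomial.eval_zero] at h
    exact h.symm
  obtain ⟨q, rfl⟩ := lineForm_dvd_of_eval_eq_zero hz (hcont g (hvan g m hg hgz))
  have hl : ∀ s : ℝ, eval (s • z) (lineForm z) = 0 := by
    intro s; simp [lineForm]; ring
  -- On the line ℝz the gradient of the product is `q` times the constant nonzero gradient of the
  -- linear form, so `q` vanishes there as well and the linear form divides twice.
  have hq : ∀ s : ℝ, s ≠ 0 → eval (s • z) q = 0 := by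
    intro s hs
    have e0 := hvan _ _ hg.pderiv h0 s hs
    have e1 := hvan _ _ hg.pderiv h1 s hs
    rw [pderiv_mul, map_add, map_mul, map_mul, hl, zero_mul, add_zero] at e0 e1
    have d0 : eval (s • z) (pderiv 0 (lineForm z)) = z 1 := by
      simp [lineForm]
    have d1 : eval (s • z) (pderiv 1 (lineForm z)) = -z 0 := by
      simp [lineForm]
    rw [d0] at e0
    rw [d1] at e1
    by_contra hne
    apply hz
    ext i
    fin_cases i
    · simpa [hne] using e1
    · simpa [hne] using e0
  obtain ⟨r, rfl⟩ := lineForm_dvd_of_eval_eq_zero hz (hcont q hq)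
  have hu := hsq (lineForm z) ⟨r, by ring⟩
  have := hu.map (eval z)
  have hlz := hl 1
  rw [one_smul] at hlz
  rw [hlz] at this
  exact not_isUnit_zero this

/-- The Hessian determinant of `g` in the orthogonal frame `q`, `q^⊥`. -/
theorem eval_hess_mul_sq {g : MvPolynomial (Fin 2) ℝ} {m : ℕ} (hg : g.IsHomogeneous (m + 2))
    (q : Fin 2 → ℝ) :
    eval q (hess g) * (q 0 ^ 2 + q 1 ^ 2) ^ 2 =
      (m + 2) * (m + 1) * eval q g * (q 1 ^ 2 * eval q (pderiv 0 (pderiv 0 g)) -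
        2 * q 0 * q 1 * eval q (pderiv 0 (pderiv 1 g)) +
        q 0 ^ 2 * eval q (pderiv 1 (pderiv 1 g))) -
      (m + 1) ^ 2 * (-q 1 * eval q (pderiv 0 g) + q 0 * eval q (pderiv 1 g)) ^ 2 := by
  have e := euler_two hg q
  have e0 := euler_two (hg.pderiv (i := 0)) q
  have e1 := euler_two (hg.pderiv (i := 1)) q
  rw [pderiv_comm 1 0] at e0
  simp only [show m + 2 - 1 = m + 1 by omega] at e0 e1
  push_cast at e e0 e1
  simp only [hess, map_sub, map_mul, map_pow]
  set a := eval q (pderiv 0 (pderiv 0 g))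
  set b := eval q (pderiv 0 (pderiv 1 g))
  set c := eval q (pderiv 1 (pderiv 1 g))
  -- Euler's identities turn the Hessian entries in the directions (q, q^⊥) and (q, q) into first
  -- derivatives and values; the frame has determinant |q|².
  have h1 : (m + 1 : ℝ) * (-q 1 * eval q (pderiv 0 g) + q 0 * eval q (pderiv 1 g)) =
      -q 1 * (q 0 * a + q 1 * b) + q 0 * (q 0 * b + q 1 * c) := by rw [e0, e1]; ring
  have h2 : (m + 2 : ℝ) * (m + 1) * eval q g =
      q 0 * (q 0 * a + q 1 * b) + q 1 * (q 0 * b + q 1 * c) := by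
    rw [e0, e1]; linear_combination (-(m + 1 : ℝ)) * e
  rw [h2, ← mul_pow, h1]
  ring

/-- Taylor's formula to second order. Combined with `restrictLine_swap`, it reads the three leading
coefficients of `g (e + τ q)` as derivatives at `q`. -/
theorem coeff_restrictLine_two (g : MvPolynomial (Fin 2) ℝ) (q e : Fin 2 → ℝ) :
    (restrictLine g q e).coeff 0 = eval q g ∧
    (restrictLine g q e).coeff 1 = e 0 * eval q (pderiv 0 g) + e 1 * eval q (pderiv 1 g) ∧
    2 * (restrictLine g q e).coeff 2 = e 0 ^ 2 * eval q (pderiv 0 (pderiv 0 g)) +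
      2 * e 0 * e 1 * eval q (pderiv 0 (pderiv 1 g)) +
        e 1 ^ 2 * eval q (pderiv 1 (pderiv 1 g)) := by
  have hz : ∀ h : MvPolynomial (Fin 2) ℝ, (restrictLine h q e).coeff 0 = eval q h := by
    intro h
    rw [Polynomial.coeff_zero_eq_eval_zero, eval_restrictLine, zero_smul, add_zero]
  refine ⟨hz g, ?_, ?_⟩
  · have h := Polynomial.coeff_derivative (restrictLine g q e) 0
    rw [derivative_restrictLine] at h
    simp [hz] at h
    exact h.symm
  · have h := Polynomial.coeff_derivative (restrictLine g q e).derivative 0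
    have h' := Polynomial.coeff_derivative (restrictLine g q e) 1
    simp only [derivative_restrictLine, Polynomial.derivative_add, Polynomial.derivative_C_mul,
      Polynomial.coeff_add, Polynomial.coeff_C_mul, hz, zero_add] at h
    rw [derivative_restrictLine] at h'
    rw [pderiv_comm 1 0] at h
    simp at h h'
    linarith


/-! ### Counting the zeros of a form on the unit circle -/

/-- The zeros of `g` on the unit circle. -/
def circleZeros (g : MvPolynomial (Fin 2) ℝ) : Set (Fin 2 → ℝ) :=
  {z | z 0 ^ 2 + z 1 ^ 2 = 1 ∧ eval z g = 0}

theorem sq_add_sq_pos {q : Fin 2 → ℝ} (hq : q ≠ 0) : 0 < q 0 ^ 2 + q 1 ^ 2 := by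
  by_contra h
  apply hq
  ext i
  fin_cases i
  · show q 0 = 0; nlinarith [sq_nonneg (q 0), sq_nonneg (q 1)]
  · show q 1 = 0; nlinarith [sq_nonneg (q 0), sq_nonneg (q 1)]

/-- An affine chart of the projective line: since `g` does not vanish at `q`, every line of zeros
meets the affine line q^⊥ + τq at a root τ. Each root yields two antipodal points of the circle. -/
theorem circleZeros_bound_of_eval_ne_zero {g : MvPolynomial (Fin 2) ℝ} {m : ℕ}
    (hg : g.IsHomogeneous m) {q : Fin 2 → ℝ} (hgq : eval q g ≠ 0) (hq : q ≠ 0) :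
    (circleZeros g).Finite ∧
      (circleZeros g).ncard ≤ 2 * (restrictLine g ![-q 1, q 0] q).roots.toFinset.card := by
  classical
  set e : Fin 2 → ℝ := ![-q 1, q 0] with he
  set G := restrictLine g e q with hG
  have hN := sq_add_sq_pos hq
  have hG0 : G ≠ 0 := by
    intro h
    have h1 := restrictLine_swap hg q e
    rw [← hG, h] at h1
    have h2 : restrictLine g q e = 0 := by simpa using h1.symm
    apply hgq
    rw [← (coeff_restrictLine_two g q e).1, h2, Polynomial.coeff_zero]
  let w : ℝ → Fin 2 → ℝ := fun τ =>
    (Real.sqrt ((e + τ • q) 0 ^ 2 + (e + τ • q) 1 ^ 2))⁻¹ • (e + τ • q)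
  have hsub : circleZeros g ⊆
      ((G.roots.toFinset.biUnion fun τ => {w τ, -w τ} : Finset (Fin 2 → ℝ)) : Set _) := by
    rintro z ⟨hz1, hz0⟩
    set N := q 0 ^ 2 + q 1 ^ 2 with hNd
    -- Coordinates of `z` in the frame q, q^⊥; `β = 0` would place a zero on ℝq.
    set α := (z 0 * q 0 + z 1 * q 1) / N with hα
    set β := (-z 0 * q 1 + z 1 * q 0) / N with hβ
    have hz : z = α • q + β • e := by
      ext i
      fin_cases i
      · simp [hα, hβ, he]; field_simp; rw [hNd]; ring
      · simp [hα, hβ, he]; field_simp; rw [hNd]; ring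
    have hβ0 : β ≠ 0 := by
      intro h0
      rw [hz, h0, zero_smul, add_zero, eval_smul_of_isHomogeneous hg] at hz0
      rcases mul_eq_zero.1 hz0 with h | h
      · have : α = 0 := by
          by_contra hne
          exact pow_ne_zero _ hne h
        rw [hz, h0, this] at hz1
        simp at hz1
      · exact hgq h
    have hz' : z = β • (e + (α / β) • q) := by
      rw [smul_add, smul_smul, mul_div_cancel₀ _ hβ0, hz, add_comm]
    have hroot : α / β ∈ G.roots.toFinset := by
      rw [Multiset.mem_toFinset, Polynomial.mem_roots hG0]
      show Polynomial.eval _ _ = 0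
      rw [hG, eval_restrictLine]
      rw [hz', eval_smul_of_isHomogeneous hg] at hz0
      exact (mul_eq_zero.1 hz0).resolve_left (pow_ne_zero _ hβ0)
    rw [Finset.coe_biUnion, Set.mem_iUnion₂]
    refine ⟨α / β, hroot, ?_⟩
    set y := e + (α / β) • q with hy
    have hyn : β ^ 2 * (y 0 ^ 2 + y 1 ^ 2) = 1 := by
      rw [← hz1, hz']; simp; ring
    have hypos : 0 < y 0 ^ 2 + y 1 ^ 2 := by
      by_contra h
      nlinarith [sq_nonneg β]
    have hs := Real.sqrt_pos.2 hypos
    have hs2 := Real.sq_sqrt hypos.le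
    have hβsq : (β - (Real.sqrt (y 0 ^ 2 + y 1 ^ 2))⁻¹) *
        (β + (Real.sqrt (y 0 ^ 2 + y 1 ^ 2))⁻¹) = 0 := by
      have : β ^ 2 = ((Real.sqrt (y 0 ^ 2 + y 1 ^ 2))⁻¹) ^ 2 := by
        rw [inv_pow, hs2]; field_simp; exact hyn
      linear_combination this
    have hw : w (α / β) = (Real.sqrt (y 0 ^ 2 + y 1 ^ 2))⁻¹ • y := rfl
    rw [Finset.coe_pair, hw]
    rcases mul_eq_zero.1 hβsq with h | h
    · left; rw [hz', sub_eq_zero.1 h]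
    · right
      show z = _
      rw [hz', eq_neg_of_add_eq_zero_left h, neg_smul]
  refine ⟨(Finset.finite_toSet _).subset hsub, ?_⟩
  refine (Set.ncard_le_ncard hsub (Finset.finite_toSet _)).trans ?_
  rw [Set.ncard_coe_finset, mul_comm]
  exact Finset.card_biUnion_le_card_mul _ _ _ fun τ _ => Finset.card_le_two

theorem exists_eval_ne_zero_of_ne_zero {g : MvPolynomial (Fin 2) ℝ} {m : ℕ}
    (hg : g.IsHomogeneous (m + 1)) (h : g ≠ 0) : ∃ q : Fin 2 → ℝ, q ≠ 0 ∧ eval q g ≠ 0 := by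
  by_contra hcon
  push Not at hcon
  apply h
  apply MvPolynomial.funext
  intro q
  rw [map_zero]
  by_cases hq : q = 0
  · have := eval_smul_of_isHomogeneous hg 0 q
    rw [zero_smul, zero_pow (Nat.succ_ne_zero m), zero_mul] at this
    rw [hq]; exact this
  · exact hcon q hq

theorem circleZeros_bound {g : MvPolynomial (Fin 2) ℝ} {m : ℕ}
    (hg : g.IsHomogeneous (m + 1)) (h : g ≠ 0) :
    (circleZeros g).Finite ∧ (circleZeros g).ncard ≤ 2 * (m + 1) := by
  obtain ⟨q, hq, hgq⟩ := exists_eval_ne_zero_of_ne_zero hg h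
  obtain ⟨h1, h2⟩ := circleZeros_bound_of_eval_ne_zero hg hgq hq
  refine ⟨h1, h2.trans (Nat.mul_le_mul_left 2 ?_)⟩
  refine (Multiset.toFinset_card_le _).trans ((Polynomial.card_roots' _).trans ?_)
  exact (natDegree_restrictLine_le _ _ _).trans hg.totalDegree_le

/-- If the Hessian of a squarefree form of degree `m + 2` has a real zero, then at least two of the
linear factors of the form are not real. -/
theorem circleZeros_bound_of_hess_eq_zero {g : MvPolynomial (Fin 2) ℝ} {m : ℕ}
    (hg : g.IsHomogeneous (m + 2)) (hsq : Squarefree g) {q : Fin 2 → ℝ} (hq : q ≠ 0)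
    (hh : eval q (hess g) = 0) : (circleZeros g).ncard ≤ 2 * m := by
  have hN := sq_add_sq_pos hq
  have hid := eval_hess_mul_sq hg q
  rw [hh, zero_mul] at hid
  have heu := euler_two hg q
  -- If `g` vanished at `q`, the Hessian identity would kill the derivative along q^⊥ and Euler's
  -- identity the one along `q`.
  have hgq : eval q g ≠ 0 := by
    intro h0
    rw [h0, mul_zero] at heu
    rw [h0, mul_zero, zero_mul, zero_sub, eq_comm, neg_eq_zero] at hid
    have hne : ((m : ℝ) + 1) ^ 2 ≠ 0 := by positivity
    have he := pow_eq_zero_iff (two_ne_zero) |>.1 ((mul_eq_zero.1 hid).resolve_left hne)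
    refine gradient_ne_zero_of_squarefree hg hsq hq ?_ ?_ h0
    · apply mul_left_cancel₀ hN.ne'
      linear_combination q 0 * heu - q 1 * he
    · apply mul_left_cancel₀ hN.ne'
      linear_combination q 1 * heu + q 0 * he
  obtain ⟨-, hle⟩ := circleZeros_bound_of_eval_ne_zero hg hgq hq
  refine hle.trans (Nat.mul_le_mul_left 2 ?_)
  set e : Fin 2 → ℝ := ![-q 1, q 0] with he
  have hswap := restrictLine_swap hg q e
  set G := restrictLine g e q with hG
  obtain ⟨k0, k1, k2⟩ := coeff_restrictLine_two g q e
  have g2 : G.coeff (m + 2) = eval q g := by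
    rw [hswap, Polynomial.coeff_reflect, Polynomial.revAt_le le_rfl, Nat.sub_self, k0]
  have g1 : G.coeff (m + 1) = e 0 * eval q (pderiv 0 g) + e 1 * eval q (pderiv 1 g) := by
    rw [hswap, Polynomial.coeff_reflect, Polynomial.revAt_le (by omega),
      show m + 2 - (m + 1) = 1 by omega, k1]
  have g0 : 2 * G.coeff m = e 0 ^ 2 * eval q (pderiv 0 (pderiv 0 g)) +
      2 * e 0 * e 1 * eval q (pderiv 0 (pderiv 1 g)) +
        e 1 ^ 2 * eval q (pderiv 1 (pderiv 1 g)) := by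
    rw [hswap, Polynomial.coeff_reflect, Polynomial.revAt_le (by omega),
      show m + 2 - m = 2 by omega, k2]
  have hdle : G.natDegree ≤ m + 2 := (natDegree_restrictLine_le _ _ _).trans hg.totalDegree_le
  have hlead : G.coeff (m + 2) ≠ 0 := by rw [g2]; exact hgq
  have hdeg : G.natDegree = m + 2 :=
    le_antisymm hdle (Polynomial.le_natDegree_of_ne_zero hlead)
  by_contra hgt
  -- With exactly `m + 1` distinct roots there is a double root, where the gradient of `g` vanishes.
  -- With `m + 2`, the strict Newton inequality contradicts the equality that the vanishing Hessian
  -- expresses.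
  rcases Nat.lt_or_ge G.roots.toFinset.card (m + 2) with hlt | hge
  · obtain ⟨a, ha0, ha1⟩ := exists_double_root (m := m + 1) hdeg (by omega)
    rw [hG, eval_restrictLine] at ha0
    rw [hG, derivative_restrictLine] at ha1
    simp only [Polynomial.eval_add, Polynomial.eval_mul, Polynomial.eval_C,
      eval_restrictLine] at ha1
    have heu' := euler_two hg (e + a • q)
    rw [ha0, mul_zero] at heu'
    have e0 : (e + a • q) 0 = -q 1 + a * q 0 := by simp [he]
    have e1 : (e + a • q) 1 = q 0 + a * q 1 := by simp [he]
    rw [e0, e1] at heu'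
    refine gradient_ne_zero_of_squarefree hg hsq (z := e + a • q) ?_ ?_ ?_ ha0
    · intro h
      rw [h] at e0 e1
      simp only [Pi.zero_apply] at e0 e1
      exact hN.ne' (by linear_combination q 1 * e0 - q 0 * e1)
    · apply mul_left_cancel₀ hN.ne'
      linear_combination (-q 1) * heu' + (q 0 + a * q 1) * ha1
    · apply mul_left_cancel₀ hN.ne'
      linear_combination (q 0) * heu' + (q 1 - a * q 0) * ha1
  · have hnewton := newton_lt_of_card_roots hdle hlead hge
    rw [g2, g1] at hnewton
    have e0 : e 0 = -q 1 := by simp [he]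
    have e1 : e 1 = q 0 := by simp [he]
    rw [e0, e1] at hnewton g0
    have hm : (0 : ℝ) < m + 1 := by positivity
    have := mul_lt_mul_of_pos_left hnewton hm
    have h3 : (m + 1) * (2 * (m + 2) * (eval q g * G.coeff m)) =
      (m + 2) * (m + 1) * eval q g * (q 1 ^ 2 * eval q (pderiv 0 (pderiv 0 g)) -
        2 * q 0 * q 1 * eval q (pderiv 0 (pderiv 1 g)) +
        q 0 ^ 2 * eval q (pderiv 1 (pderiv 1 g))) := by
      linear_combination ((m + 2) * (m + 1) * eval q g) * g0
    rw [h3] at this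
    linarith


/-! ### Homogenization and the Hessian form -/

theorem totalDegree_pderiv_le' {σ : Type*} (g : MvPolynomial σ ℝ) (a : σ) :
    (pderiv a g).totalDegree ≤ g.totalDegree - 1 := by
  conv_lhs => rw [← sum_homogeneousComponent g, map_sum]
  refine totalDegree_finsetSum_le fun i hi => ?_
  have h := ((homogeneousComponent_isHomogeneous i g).pderiv (i := a)).totalDegree_le
  have := Finset.mem_range.1 hi
  omega

theorem pderiv_pderiv_eq_zero {σ : Type*} {g : MvPolynomial σ ℝ} (hg : g.totalDegree ≤ 1)
    (a b : σ) : pderiv a (pderiv b g) = 0 := by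
  have h := totalDegree_pderiv_le' g b
  rw [totalDegree_eq_zero_iff_eq_C.1 (by omega : (pderiv b g).totalDegree = 0), pderiv_C]

theorem eval_rename_castSucc (p : Fin 3 → ℝ) (g : MvPolynomial (Fin 2) ℝ) :
    eval p (rename Fin.castSucc g) = eval ![p 0, p 1] g := by
  rw [eval_rename]
  congr 2
  ext i
  fin_cases i <;> rfl

theorem eval_homogenizeTo {d : ℕ} {g : MvPolynomial (Fin 2) ℝ} (hg : g.totalDegree ≤ d)
    {p : Fin 3 → ℝ} (hp : p 2 ≠ 0) :
    eval p (homogenizeTo d g) = p 2 ^ d * eval ![p 0 / p 2, p 1 / p 2] g := by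
  have hsum : g = ∑ i ∈ Finset.range (d + 1), homogeneousComponent i g := by
    conv_lhs => rw [← sum_homogeneousComponent g]
    refine Finset.sum_subset (by simpa using hg) fun i _ hi => ?_
    apply homogeneousComponent_eq_zero
    simp at hi; omega
  conv_rhs => rw [hsum]
  simp only [homogenizeTo, map_sum, map_mul, map_pow, eval_X, eval_rename_castSucc]
  rw [Finset.mul_sum]
  refine Finset.sum_congr rfl fun i hi => ?_
  have hx : (![p 0, p 1] : Fin 2 → ℝ) = p 2 • ![p 0 / p 2, p 1 / p 2] := by
    ext j; fin_cases j <;> simp <;> field_simp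
  have := Finset.mem_range.1 hi
  rw [hx, eval_smul_of_isHomogeneous (homogeneousComponent_isHomogeneous i g), ← mul_assoc,
    ← pow_add, Nat.sub_add_cancel (by omega)]

theorem pderiv_pderiv_homForm (f : MvPolynomial (Fin 2) ℝ) (a b : Fin 2) :
    pderiv a.castSucc (pderiv b.castSucc (homForm f)) =
      ∑ i ∈ Finset.range (f.totalDegree + 1), X 2 ^ (f.totalDegree - i) *
        rename Fin.castSucc (pderiv a (pderiv b (homogeneousComponent i f))) := by
  have hX : ∀ (c : Fin 2) (j : ℕ), pderiv c.castSucc (X 2 ^ j : MvPolynomial (Fin 3) ℝ) = 0 := by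
    intro c j
    rw [pderiv_pow, pderiv_X_of_ne, mul_zero]
    fin_cases c <;> decide
  simp only [homForm, homogenizeTo, map_sum, pderiv_mul, hX, zero_mul, zero_add,
    pderiv_rename (Fin.castSucc_injective 2)]

theorem sq_mul_eval_pderiv_homForm (f : MvPolynomial (Fin 2) ℝ) (a b : Fin 2)
    {p : Fin 3 → ℝ} (hp : p 2 ≠ 0) :
    p 2 ^ 2 * eval p (pderiv a.castSucc (pderiv b.castSucc (homForm f))) =
      p 2 ^ f.totalDegree * eval ![p 0 / p 2, p 1 / p 2] (pderiv a (pderiv b f)) := by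
  have hs : pderiv a (pderiv b f) = ∑ i ∈ Finset.range (f.totalDegree + 1),
      pderiv a (pderiv b (homogeneousComponent i f)) := by
    conv_lhs => rw [← sum_homogeneousComponent f]
    simp only [map_sum]
  rw [pderiv_pderiv_homForm, hs]
  simp only [map_sum, map_mul, map_pow, eval_X, eval_rename_castSucc]
  rw [Finset.mul_sum, Finset.mul_sum]
  refine Finset.sum_congr rfl fun i hi => ?_
  have hx : (![p 0, p 1] : Fin 2 → ℝ) = p 2 • ![p 0 / p 2, p 1 / p 2] := by
    ext j; fin_cases j <;> simp <;> field_simp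
  have hi' := Finset.mem_range.1 hi
  have hh := homogeneousComponent_isHomogeneous i f
  -- For `i < 2` the degree `i - 2` truncates, but the second derivatives vanish.
  rcases Nat.lt_or_ge i 2 with h2 | h2
  · rw [pderiv_pderiv_eq_zero (hh.totalDegree_le.trans (by omega))]
    simp
  · rw [hx, eval_smul_of_isHomogeneous (hh.pderiv.pderiv), ← mul_assoc, ← mul_assoc,
      ← pow_add, ← pow_add]
    congr 2
    omega

theorem eval_pderiv_homForm_of_eq_zero (f : MvPolynomial (Fin 2) ℝ) (a b : Fin 2)
    {p : Fin 3 → ℝ} (hp : p 2 = 0) :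
    eval p (pderiv a.castSucc (pderiv b.castSucc (homForm f))) =
      eval ![p 0, p 1] (pderiv a (pderiv b (topForm f))) := by
  rw [pderiv_pderiv_homForm]
  simp only [map_sum, map_mul, map_pow, eval_X, eval_rename_castSucc, hp]
  rw [Finset.sum_range_succ, Finset.sum_eq_zero]
  · simp [topForm]
  · intro i hi
    have := Finset.mem_range.1 hi
    rw [zero_pow (by omega), zero_mul]

theorem hess_eq_zero {f : MvPolynomial (Fin 2) ℝ} (hf : f.totalDegree ≤ 1) : hess f = 0 := by
  simp [hess, pderiv_pderiv_eq_zero hf]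

theorem totalDegree_hess_le (f : MvPolynomial (Fin 2) ℝ) :
    (hess f).totalDegree ≤ 2 * f.totalDegree - 4 := by
  have h : ∀ a b : Fin 2, (pderiv a (pderiv b f)).totalDegree ≤ f.totalDegree - 2 := fun a b =>
    ((totalDegree_pderiv_le' _ a).trans (Nat.sub_le_sub_right (totalDegree_pderiv_le' f b) 1))
  refine (totalDegree_sub _ _).trans (max_le ?_ ?_)
  · refine (totalDegree_mul _ _).trans ?_
    have := h 0 0; have := h 1 1; omega
  · refine (totalDegree_pow _ _).trans ?_
    have := h 0 1; omega

/-- Multiplication by ω⁴ makes both sides vanish on ω = 0, so it suffices to dehomogenize at the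
other points; the bound on the degree makes 4 + (2n - 4) equal to 2n in ℕ. -/
theorem hessForm_eq {f : MvPolynomial (Fin 2) ℝ} (hf : 2 ≤ f.totalDegree) :
    hessForm f = pderiv 0 (pderiv 0 (homForm f)) * pderiv 1 (pderiv 1 (homForm f)) -
      pderiv 0 (pderiv 1 (homForm f)) ^ 2 := by
  have hX : (X 2 : MvPolynomial (Fin 3) ℝ) ≠ 0 := X_ne_zero _
  apply mul_left_cancel₀ (pow_ne_zero 4 hX)
  apply MvPolynomial.funext
  intro p
  by_cases hp : p 2 = 0
  · simp [hp]
  · have e00 := sq_mul_eval_pderiv_homForm f 0 0 hp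
    have e01 := sq_mul_eval_pderiv_homForm f 0 1 hp
    have e11 := sq_mul_eval_pderiv_homForm f 1 1 hp
    simp only [Fin.castSucc_zero, Fin.castSucc_one] at e00 e01 e11
    have eh : eval p (hessForm f) = _ := eval_homogenizeTo (totalDegree_hess_le f) hp
    simp only [map_mul, map_pow, map_sub, eval_X, eh, hess]
    have hpow : p 2 ^ 4 * p 2 ^ (2 * f.totalDegree - 4) =
        p 2 ^ f.totalDegree * p 2 ^ f.totalDegree := by
      rw [← pow_add, ← pow_add]; congr 1; omega
    rw [← mul_assoc, hpow]
    linear_combination (-(p 2 ^ 2 * eval p (pderiv 1 (pderiv 1 (homForm f))))) * e00 -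
      (p 2 ^ f.totalDegree * eval ![p 0 / p 2, p 1 / p 2] (pderiv 0 (pderiv 0 f))) * e11 +
      (p 2 ^ 2 * eval p (pderiv 0 (pderiv 1 (homForm f))) +
        p 2 ^ f.totalDegree * eval ![p 0 / p 2, p 1 / p 2] (pderiv 0 (pderiv 1 f))) * e01

theorem eval_hessForm_of_eq_zero {f : MvPolynomial (Fin 2) ℝ} (hf : 2 ≤ f.totalDegree)
    {p : Fin 3 → ℝ} (hp : p 2 = 0) :
    eval p (hessForm f) = eval ![p 0, p 1] (hess (topForm f)) := by
  have e00 := eval_pderiv_homForm_of_eq_zero f 0 0 hp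
  have e01 := eval_pderiv_homForm_of_eq_zero f 0 1 hp
  have e11 := eval_pderiv_homForm_of_eq_zero f 1 1 hp
  simp only [Fin.castSucc_zero, Fin.castSucc_one] at e00 e01 e11
  rw [hessForm_eq hf]
  simp only [hess, map_sub, map_mul, map_pow, e00, e01, e11]

theorem hessForm_eq_zero {f : MvPolynomial (Fin 2) ℝ} (hf : f.totalDegree ≤ 1) :
    hessForm f = 0 := by
  simp [hessForm, homogenizeTo, hess_eq_zero hf]


/-! ### Eigenlines in a frame of the tangent plane -/

theorem dotProduct_three (x y : Fin 3 → ℝ) : x ⬝ᵥ y = x 0 * y 0 + x 1 * y 1 + x 2 * y 2 :=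
  Fin.sum_univ_three _

/-- The rotation `q × ·` has square -1 on the tangent plane, so it can be moved to the other side;
the result is easy to test against a frame. -/
theorem cross_eq_smul_iff {q ξ η : Fin 3 → ℝ} {l : ℝ} (hq : q ⬝ᵥ q = 1) (hξ : q ⬝ᵥ ξ = 0)
    (hη : q ⬝ᵥ η = 0) : crossProduct q η = l • ξ ↔ η + l • crossProduct q ξ = 0 := by
  simp only [dotProduct_three] at hq hξ hη
  constructor
  · intro h
    have h0 := congrFun h 0
    have h1 := congrFun h 1
    have h2 := congrFun h 2
    simp [cross_apply] at h0 h1 h2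
    ext i
    fin_cases i
    · simp [cross_apply]; linear_combination (-η 0) * hq + q 0 * hη - q 1 * h2 + q 2 * h1
    · simp [cross_apply]; linear_combination (-η 1) * hq + q 1 * hη - q 2 * h0 + q 0 * h2
    · simp [cross_apply]; linear_combination (-η 2) * hq + q 2 * hη - q 0 * h1 + q 1 * h0
  · intro h
    have h0 := congrFun h 0
    have h1 := congrFun h 1
    have h2 := congrFun h 2
    simp [cross_apply] at h0 h1 h2
    ext i
    fin_cases i
    · simp [cross_apply]
      linear_combination q 1 * h2 - q 2 * h1 + l * ξ 0 * hq - l * q 0 * hξ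
    · simp [cross_apply]
      linear_combination q 2 * h0 - q 0 * h2 + l * ξ 1 * hq - l * q 1 * hξ
    · simp [cross_apply]
      linear_combination q 0 * h1 - q 1 * h0 + l * ξ 2 * hq - l * q 2 * hξ

theorem eq_zero_of_dotProduct_frame {q e₁ e₂ ζ : Fin 3 → ℝ} (hδ : q ⬝ᵥ crossProduct e₁ e₂ ≠ 0)
    (h0 : q ⬝ᵥ ζ = 0) (h1 : e₁ ⬝ᵥ ζ = 0) (h2 : e₂ ⬝ᵥ ζ = 0) : ζ = 0 := by
  simp only [dotProduct_three] at h0 h1 h2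
  ext i
  apply mul_left_cancel₀ hδ
  simp only [dotProduct_three, cross_apply]
  fin_cases i
  · simp [-mul_eq_zero]
    linear_combination (e₁ 1 * e₂ 2 - e₁ 2 * e₂ 1) * h0 + (e₂ 1 * q 2 - e₂ 2 * q 1) * h1 +
      (q 1 * e₁ 2 - q 2 * e₁ 1) * h2
  · simp [-mul_eq_zero]
    linear_combination (e₁ 2 * e₂ 0 - e₁ 0 * e₂ 2) * h0 + (e₂ 2 * q 0 - e₂ 0 * q 2) * h1 +
      (q 2 * e₁ 0 - q 0 * e₁ 2) * h2
  · simp [-mul_eq_zero]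
    linear_combination (e₁ 0 * e₂ 1 - e₁ 1 * e₂ 0) * h0 + (e₂ 0 * q 1 - e₂ 1 * q 0) * h1 +
      (q 0 * e₁ 1 - q 1 * e₁ 0) * h2

/-- The vector `X e₁ + Y e₂`, projected orthogonally to the unit vector `q`. -/
def tangentVec (q e₁ e₂ : Fin 3 → ℝ) (X Y : ℝ) : Fin 3 → ℝ :=
  X • e₁ + Y • e₂ - (X * (q ⬝ᵥ e₁) + Y * (q ⬝ᵥ e₂)) • q

theorem dotProduct_tangentVec {q : Fin 3 → ℝ} (hq : q ⬝ᵥ q = 1) (e₁ e₂ : Fin 3 → ℝ) (X Y : ℝ) :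
    q ⬝ᵥ tangentVec q e₁ e₂ X Y = 0 := by
  simp only [tangentVec, dotProduct_sub, dotProduct_add, dotProduct_smul, hq, smul_eq_mul]
  ring

theorem exists_eq_tangentVec {q e₁ e₂ ξ : Fin 3 → ℝ} (hq : q ⬝ᵥ q = 1)
    (hδ : q ⬝ᵥ crossProduct e₁ e₂ ≠ 0) (hξ : q ⬝ᵥ ξ = 0) :
    ∃ X Y : ℝ, ξ = tangentVec q e₁ e₂ X Y := by
  set δ := q ⬝ᵥ crossProduct e₁ e₂ with hδd
  -- Cramer's rule in the basis `q`, `e₁`, `e₂`.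
  set X := (q ⬝ᵥ crossProduct ξ e₂) / δ with hX
  set Y := (q ⬝ᵥ crossProduct e₁ ξ) / δ with hY
  set Z := (ξ ⬝ᵥ crossProduct e₁ e₂) / δ with hZ
  have h : ξ = Z • q + X • e₁ + Y • e₂ := by
    ext i
    apply mul_left_cancel₀ hδ
    have hX' : δ * X = q ⬝ᵥ crossProduct ξ e₂ := mul_div_cancel₀ _ hδ
    have hY' : δ * Y = q ⬝ᵥ crossProduct e₁ ξ := mul_div_cancel₀ _ hδ
    have hZ' : δ * Z = ξ ⬝ᵥ crossProduct e₁ e₂ := mul_div_cancel₀ _ hδ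
    simp only [Pi.add_apply, Pi.smul_apply, smul_eq_mul, mul_add, ← mul_assoc, hX', hY', hZ']
    rw [hδd]
    simp only [dotProduct_three, cross_apply]
    fin_cases i <;> simp <;> ring
  refine ⟨X, Y, ?_⟩
  have h2 := hξ
  rw [h] at h2
  simp only [dotProduct_add, dotProduct_smul, hq, smul_eq_mul] at h2
  have hZ2 : Z = -(X * (q ⬝ᵥ e₁) + Y * (q ⬝ᵥ e₂)) := by linarith
  rw [tangentVec, sub_eq_add_neg, ← neg_smul, ← hZ2]
  rw [h]
  abel_nf

section EigenLine

variable {M : Matrix (Fin 3) (Fin 3) ℝ} {q e₁ e₂ : Fin 3 → ℝ} {l : ℝ}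

theorem dotProduct_mulVec_tangentVec (hMq : M.mulVec q = 0) (e : Fin 3 → ℝ) (X Y : ℝ) :
    e ⬝ᵥ M.mulVec (tangentVec q e₁ e₂ X Y) =
      X * (e ⬝ᵥ M.mulVec e₁) + Y * (e ⬝ᵥ M.mulVec e₂) := by
  simp [tangentVec, Matrix.mulVec_sub, Matrix.mulVec_add, Matrix.mulVec_smul, hMq]

theorem dotProduct_mulVec_comm (hM : M.IsSymm) (x y : Fin 3 → ℝ) :
    x ⬝ᵥ M.mulVec y = y ⬝ᵥ M.mulVec x := by
  rw [Matrix.dotProduct_mulVec, ← Matrix.mulVec_transpose, hM.eq, dotProduct_comm]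

/-- The two equations are the pairings of Mξ + l (q × ξ) with `e₁` and `e₂`; the pairing with `q` is
automatic because `M` is symmetric and kills `q`. For the same reason `e₁` and `e₂` need not be
tangent: projecting them does not change the form. -/
theorem tangentVec_mem_iff (hM : M.IsSymm) (hMq : M.mulVec q = 0) (hq : q ⬝ᵥ q = 1)
    (hδ : q ⬝ᵥ crossProduct e₁ e₂ ≠ 0) (X Y : ℝ) :
    crossProduct q (M.mulVec (tangentVec q e₁ e₂ X Y)) = l • tangentVec q e₁ e₂ X Y ↔
      (e₁ ⬝ᵥ M.mulVec e₁) * X +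
        (e₁ ⬝ᵥ M.mulVec e₂ - l * (q ⬝ᵥ crossProduct e₁ e₂)) * Y = 0 ∧
      (e₁ ⬝ᵥ M.mulVec e₂ + l * (q ⬝ᵥ crossProduct e₁ e₂)) * X +
        (e₂ ⬝ᵥ M.mulVec e₂) * Y = 0 := by
  set ξ := tangentVec q e₁ e₂ X Y with hξ
  have hqM : ∀ y, q ⬝ᵥ M.mulVec y = 0 := fun y => by
    rw [dotProduct_mulVec_comm hM, hMq, dotProduct_zero]
  rw [cross_eq_smul_iff hq (dotProduct_tangentVec hq _ _ _ _) (hqM ξ)]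
  have d1 : e₁ ⬝ᵥ crossProduct q ξ = -(Y * (q ⬝ᵥ crossProduct e₁ e₂)) := by
    rw [hξ, tangentVec]; simp only [dotProduct_three, cross_apply]; simp; ring
  have d2 : e₂ ⬝ᵥ crossProduct q ξ = X * (q ⬝ᵥ crossProduct e₁ e₂) := by
    rw [hξ, tangentVec]; simp only [dotProduct_three, cross_apply]; simp; ring
  have s1 : e₁ ⬝ᵥ (M.mulVec ξ + l • crossProduct q ξ) = (e₁ ⬝ᵥ M.mulVec e₁) * X +
        (e₁ ⬝ᵥ M.mulVec e₂ - l * (q ⬝ᵥ crossProduct e₁ e₂)) * Y := by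
    rw [dotProduct_add, dotProduct_smul, d1, hξ, dotProduct_mulVec_tangentVec hMq, smul_eq_mul]
    ring
  have s2 : e₂ ⬝ᵥ (M.mulVec ξ + l • crossProduct q ξ) =
      (e₁ ⬝ᵥ M.mulVec e₂ + l * (q ⬝ᵥ crossProduct e₁ e₂)) * X +
        (e₂ ⬝ᵥ M.mulVec e₂) * Y := by
    rw [dotProduct_add, dotProduct_smul, d2, hξ, dotProduct_mulVec_tangentVec hMq, smul_eq_mul,
      dotProduct_mulVec_comm hM e₂ e₁]
    ring
  rw [← s1, ← s2]
  constructor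
  · intro h
    rw [h, dotProduct_zero, dotProduct_zero]
    exact ⟨rfl, rfl⟩
  · rintro ⟨h1, h2⟩
    refine eq_zero_of_dotProduct_frame hδ ?_ h1 h2
    rw [dotProduct_add, dotProduct_smul, hqM, dot_self_cross, smul_zero, add_zero]

theorem exists_smul_eq_of_det_eq_zero {X Y X₀ Y₀ : ℝ} (h₀ : X₀ ≠ 0 ∨ Y₀ ≠ 0)
    (h : X * Y₀ = Y * X₀) : ∃ t : ℝ, X = t * X₀ ∧ Y = t * Y₀ := by
  rcases h₀ with h₀ | h₀
  · exact ⟨X / X₀, by field_simp, by field_simp; linarith⟩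
  · exact ⟨Y / Y₀, by field_simp; linarith, by field_simp⟩

theorem det_eq_zero_of_row {a b X Y X₀ Y₀ : ℝ} (hab : a ≠ 0 ∨ b ≠ 0)
    (h : a * X + b * Y = 0) (h₀ : a * X₀ + b * Y₀ = 0) : X * Y₀ = Y * X₀ := by
  rcases hab with ha | hb
  · apply mul_left_cancel₀ ha; linear_combination Y₀ * h - Y * h₀
  · apply mul_left_cancel₀ hb; linear_combination X * h₀ - X₀ * h

/-- A nonzero vector spans the eigenline as soon as it solves the two eigen-equations in a frame
and these equations are not both trivial. -/
theorem mem_eigenline_iff_mem_span (hM : M.IsSymm) (hMq : M.mulVec q = 0) (hq : q ⬝ᵥ q = 1)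
    (hδ : q ⬝ᵥ crossProduct e₁ e₂ ≠ 0) {X₀ Y₀ : ℝ} (h₀ : X₀ ≠ 0 ∨ Y₀ ≠ 0)
    (h1 : (e₁ ⬝ᵥ M.mulVec e₁) * X₀ +
        (e₁ ⬝ᵥ M.mulVec e₂ - l * (q ⬝ᵥ crossProduct e₁ e₂)) * Y₀ = 0)
    (h2 : (e₁ ⬝ᵥ M.mulVec e₂ + l * (q ⬝ᵥ crossProduct e₁ e₂)) * X₀ +
        (e₂ ⬝ᵥ M.mulVec e₂) * Y₀ = 0)
    (hne : (e₁ ⬝ᵥ M.mulVec e₁ ≠ 0 ∨ e₁ ⬝ᵥ M.mulVec e₂ - l * (q ⬝ᵥ crossProduct e₁ e₂) ≠ 0) ∨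
      (e₁ ⬝ᵥ M.mulVec e₂ + l * (q ⬝ᵥ crossProduct e₁ e₂) ≠ 0 ∨ e₂ ⬝ᵥ M.mulVec e₂ ≠ 0))
    (ξ : Fin 3 → ℝ) :
    (q ⬝ᵥ ξ = 0 ∧ crossProduct q (M.mulVec ξ) = l • ξ) ↔
      ξ ∈ Submodule.span ℝ {tangentVec q e₁ e₂ X₀ Y₀} := by
  rw [Submodule.mem_span_singleton]
  constructor
  · rintro ⟨hξ, hξ'⟩
    obtain ⟨X, Y, rfl⟩ := exists_eq_tangentVec hq hδ hξ
    rw [tangentVec_mem_iff hM hMq hq hδ] at hξ'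
    have hdet : X * Y₀ = Y * X₀ := by
      rcases hne with h | h
      · exact det_eq_zero_of_row h hξ'.1 h1
      · exact det_eq_zero_of_row h hξ'.2 h2
    obtain ⟨t, rfl, rfl⟩ := exists_smul_eq_of_det_eq_zero h₀ hdet
    refine ⟨t, ?_⟩
    simp only [tangentVec, smul_sub, smul_add, smul_smul]
    congr 2
    ring
  · rintro ⟨t, rfl⟩
    have h := (tangentVec_mem_iff (l := l) hM hMq hq hδ X₀ Y₀).2 ⟨h1, h2⟩
    refine ⟨by rw [dotProduct_smul, dotProduct_tangentVec hq, smul_zero], ?_⟩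
    rw [Matrix.mulVec_smul, map_smul, h, smul_comm]

theorem tangentVec_ne_zero (hδ : q ⬝ᵥ crossProduct e₁ e₂ ≠ 0) {X Y : ℝ} (h : X ≠ 0 ∨ Y ≠ 0) :
    tangentVec q e₁ e₂ X Y ≠ 0 := by
  intro h0
  have d1 : e₁ ⬝ᵥ crossProduct q (tangentVec q e₁ e₂ X Y) =
      -(Y * (q ⬝ᵥ crossProduct e₁ e₂)) := by
    rw [tangentVec]; simp only [dotProduct_three, cross_apply]; simp; ring
  have d2 : e₂ ⬝ᵥ crossProduct q (tangentVec q e₁ e₂ X Y) = X * (q ⬝ᵥ crossProduct e₁ e₂) := by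
    rw [tangentVec]; simp only [dotProduct_three, cross_apply]; simp; ring
  rw [h0] at d1 d2
  simp only [map_zero, dotProduct_zero] at d1 d2
  rcases h with h | h
  · exact mul_ne_zero h hδ d2.symm
  · exact mul_ne_zero h hδ (by linarith)

end EigenLine

theorem extForm_isSymm (f : MvPolynomial (Fin 2) ℝ) (p : Fin 3 → ℝ) : (extForm f p).IsSymm := by
  ext i j
  fin_cases i <;> fin_cases j <;> simp [extForm]

theorem extForm_mulVec_self (f : MvPolynomial (Fin 2) ℝ) (p : Fin 3 → ℝ) :
    (extForm f p).mulVec p = 0 := by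
  ext i
  simp only [Matrix.mulVec, dotProduct_three]
  fin_cases i <;> simp [extForm] <;> ring

/-- Description of the lines of the fields in a frame of the tangent plane. -/
theorem lineField_eq_span {f : MvPolynomial (Fin 2) ℝ} {k : ℕ} {q e₁ e₂ : Fin 3 → ℝ}
    (hq : q ⬝ᵥ q = 1) {δ l α β γ : ℝ} (hδ : δ ≠ 0) (hδ' : q ⬝ᵥ crossProduct e₁ e₂ = δ)
    (hl : (-1) ^ k * Real.sqrt (disc f q) = l) (hα : e₁ ⬝ᵥ (extForm f q).mulVec e₁ = α)
    (hβ : e₁ ⬝ᵥ (extForm f q).mulVec e₂ = β) (hγ : e₂ ⬝ᵥ (extForm f q).mulVec e₂ = γ)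
    {X₀ Y₀ : ℝ} (h₀ : X₀ ≠ 0 ∨ Y₀ ≠ 0) (h1 : α * X₀ + (β - l * δ) * Y₀ = 0)
    (h2 : (β + l * δ) * X₀ + γ * Y₀ = 0)
    (hne : (α ≠ 0 ∨ β - l * δ ≠ 0) ∨ (β + l * δ ≠ 0 ∨ γ ≠ 0)) :
    lineField f k q = Submodule.span ℝ {tangentVec q e₁ e₂ X₀ Y₀} := by
  subst hδ' hα hβ hγ
  ext ξ
  rw [← mem_eigenline_iff_mem_span (extForm_isSymm f q) (extForm_mulVec_self f q) hq hδ h₀ h1 h2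
    hne ξ, ← hl]
  rfl

/-- The determinant condition gives the 2 × 2 system rank at most one, and a nonzero coefficient
gives rank exactly one; a nonzero row supplies the kernel vector. -/
theorem finrank_lineField_eq_one {f : MvPolynomial (Fin 2) ℝ} {k : ℕ} {q e₁ e₂ : Fin 3 → ℝ}
    (hq : q ⬝ᵥ q = 1) {δ l α β γ : ℝ} (hδ : δ ≠ 0) (hδ' : q ⬝ᵥ crossProduct e₁ e₂ = δ)
    (hl : (-1) ^ k * Real.sqrt (disc f q) = l) (hα : e₁ ⬝ᵥ (extForm f q).mulVec e₁ = α)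
    (hβ : e₁ ⬝ᵥ (extForm f q).mulVec e₂ = β) (hγ : e₂ ⬝ᵥ (extForm f q).mulVec e₂ = γ)
    (hdet : α * γ = (β - l * δ) * (β + l * δ))
    (hne : (α ≠ 0 ∨ β - l * δ ≠ 0) ∨ (β + l * δ ≠ 0 ∨ γ ≠ 0)) :
    Module.finrank ℝ (lineField f k q) = 1 := by
  have main : ∃ X₀ Y₀ : ℝ, (X₀ ≠ 0 ∨ Y₀ ≠ 0) ∧ α * X₀ + (β - l * δ) * Y₀ = 0 ∧
      (β + l * δ) * X₀ + γ * Y₀ = 0 := by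
    rcases hne with h | h
    · exact ⟨-(β - l * δ), α, by rwa [neg_ne_zero, or_comm], by ring, by linear_combination hdet⟩
    · exact ⟨-γ, β + l * δ, by rwa [neg_ne_zero, or_comm], by linear_combination -hdet, by ring⟩
  obtain ⟨X₀, Y₀, h₀, h1, h2⟩ := main
  rw [lineField_eq_span hq hδ hδ' hl hα hβ hγ h₀ h1 h2 hne]
  exact finrank_span_singleton (tangentVec_ne_zero (by rwa [hδ']) h₀)


/-! ### Location of the singular points -/

theorem topForm_isHomogeneous (f : MvPolynomial (Fin 2) ℝ) :
    (topForm f).IsHomogeneous f.totalDegree := homogeneousComponent_isHomogeneous _ _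

theorem sq_signed_sqrt (k : ℕ) {x : ℝ} (hx : 0 ≤ x) : ((-1) ^ k * Real.sqrt x) ^ 2 = x := by
  rw [mul_pow, Real.sq_sqrt hx, ← pow_mul, mul_comm k 2, pow_mul]
  simp

/-- Off the equator the first two coordinate vectors project to a frame with determinant ω, in which
Q is ω² times the Hessian matrix of F in u, v. The eigen-equations are both trivial only if that
matrix vanishes, that is, over a flat point. -/
theorem singularPoints_subset_equator {f : MvPolynomial (Fin 2) ℝ} (hn : 2 ≤ f.totalDegree)
    (hflat : NoFlatPoints f) (k : ℕ) : singularPoints f k ⊆ equator := by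
  rintro q ⟨⟨hq, hdisc⟩, hrank⟩
  refine ⟨hq, ?_⟩
  by_contra hw
  apply hrank
  set l := (-1) ^ k * Real.sqrt (disc f q) with hl
  have hl2 : l ^ 2 = disc f q := sq_signed_sqrt k hdisc
  rw [disc, hessForm_eq hn] at hl2
  simp only [map_sub, map_mul, map_pow] at hl2
  set a := eval q (pderiv 0 (pderiv 0 (homForm f))) with ha
  set b := eval q (pderiv 0 (pderiv 1 (homForm f))) with hb
  set c := eval q (pderiv 1 (pderiv 1 (homForm f))) with hc
  have hwp : q 2 ^ 2 ≠ 0 := pow_ne_zero _ hw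
  have key : a ≠ 0 ∨ b ≠ 0 ∨ c ≠ 0 := by
    by_contra hcon
    push Not at hcon
    obtain ⟨h1, h2, h3⟩ := hcon
    have e00 := sq_mul_eval_pderiv_homForm f 0 0 hw
    have e01 := sq_mul_eval_pderiv_homForm f 0 1 hw
    have e11 := sq_mul_eval_pderiv_homForm f 1 1 hw
    simp only [Fin.castSucc_zero, Fin.castSucc_one] at e00 e01 e11
    rw [← ha, h1, mul_zero, eq_comm] at e00
    rw [← hb, h2, mul_zero, eq_comm] at e01
    rw [← hc, h3, mul_zero, eq_comm] at e11
    have hpow := pow_ne_zero f.totalDegree hw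
    exact hflat _ ⟨(mul_eq_zero.1 e00).resolve_left hpow, (mul_eq_zero.1 e01).resolve_left hpow,
      (mul_eq_zero.1 e11).resolve_left hpow⟩
  refine finrank_lineField_eq_one (e₁ := ![1, 0, 0]) (e₂ := ![0, 1, 0]) (δ := q 2) (l := l)
    (α := q 2 ^ 2 * a) (β := q 2 ^ 2 * b) (γ := q 2 ^ 2 * c) hq hw ?_ hl.symm ?_ ?_ ?_ ?_ ?_
  · simp only [dotProduct_three, cross_apply]; simp
  · simp only [Matrix.mulVec, dotProduct_three]; simp [extForm, ha]
  · simp only [Matrix.mulVec, dotProduct_three]; simp [extForm, hb]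
  · simp only [Matrix.mulVec, dotProduct_three]; simp [extForm, hc]
  · linear_combination q 2 ^ 2 * hl2
  · by_contra hcon
    push Not at hcon
    obtain ⟨⟨h1, h2⟩, h3, h4⟩ := hcon
    have hb0 : q 2 ^ 2 * b = 0 := by linarith
    rcases key with h | h | h
    · exact mul_ne_zero hwp h h1
    · exact mul_ne_zero hwp h hb0
    · exact mul_ne_zero hwp h h4

/-- The second order Euler identity of a binary form. -/
theorem euler_second {g : MvPolynomial (Fin 2) ℝ} {n : ℕ} (hg : g.IsHomogeneous n) (hn : 1 ≤ n)
    (x : Fin 2 → ℝ) :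
    x 0 ^ 2 * eval x (pderiv 0 (pderiv 0 g)) + 2 * x 0 * x 1 * eval x (pderiv 0 (pderiv 1 g)) +
      x 1 ^ 2 * eval x (pderiv 1 (pderiv 1 g)) = n * (n - 1) * eval x g := by
  have e := euler_two hg x
  have e0 := euler_two (hg.pderiv (i := 0)) x
  have e1 := euler_two (hg.pderiv (i := 1)) x
  rw [pderiv_comm 1 0] at e0
  push_cast [hn] at e0 e1
  linear_combination x 0 * e0 + x 1 * e1 + (n - 1 : ℝ) * e

/-- On the equator Q is n(n-1) f_n dω² and the eigenvalue is 0. Where f_n is nonzero, the field is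
thus the direction of the equator. -/
theorem eval_topForm_eq_zero_of_singular {f : MvPolynomial (Fin 2) ℝ} (hn : 2 ≤ f.totalDegree)
    {k : ℕ} {q : Fin 3 → ℝ} (hq : q ∈ singularPointsAtInfinity f k) :
    eval ![q 0, q 1] (topForm f) = 0 := by
  obtain ⟨⟨-, hrank⟩, hq1, hq2⟩ := hq
  by_contra hne
  apply hrank
  have e00 := eval_pderiv_homForm_of_eq_zero f 0 0 hq2
  have e01 := eval_pderiv_homForm_of_eq_zero f 0 1 hq2
  have e11 := eval_pderiv_homForm_of_eq_zero f 1 1 hq2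
  simp only [Fin.castSucc_zero, Fin.castSucc_one] at e00 e01 e11
  have hS := euler_second (topForm_isHomogeneous f) (by omega) ![q 0, q 1]
  rw [← e00, ← e01, ← e11] at hS
  simp only [Matrix.cons_val_zero, Matrix.cons_val_one] at hS
  have hq1' : q ⬝ᵥ q = 1 := hq1
  have hγ : (f.totalDegree : ℝ) * (f.totalDegree - 1) * eval ![q 0, q 1] (topForm f) ≠ 0 := by
    have h2 : (2 : ℝ) ≤ f.totalDegree := by exact_mod_cast hn
    exact mul_ne_zero (mul_ne_zero (by linarith) (by linarith)) hne
  refine finrank_lineField_eq_one (e₁ := ![-q 1, q 0, 0]) (e₂ := ![0, 0, 1]) (δ := 1) (l := 0)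
    (α := 0) (β := 0)
    (γ := f.totalDegree * (f.totalDegree - 1) * eval ![q 0, q 1] (topForm f))
    hq1 one_ne_zero ?_ ?_ ?_ ?_ ?_ (by ring) (Or.inr (Or.inr hγ))
  · rw [dotProduct_three, hq2] at hq1'
    simp only [dotProduct_three, cross_apply]; simp; linarith
  · simp [disc, hq2]
  · simp only [Matrix.mulVec, dotProduct_three]; simp [extForm, hq2]
  · simp only [Matrix.mulVec, dotProduct_three]; simp [extForm, hq2]
  · rw [← hS]
    simp only [Matrix.mulVec, dotProduct_three]; simp [extForm]


/-! ### Continuous angles along a path of lines -/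

section Angle

/-- Along `[a, b]` the lines `L t` are spanned by vectors with a continuous angle in the frame
`e₁`, `e₂`, which goes from `α` to `β`. -/
def AngleOn (L : ℝ → Submodule ℝ (Fin 3 → ℝ)) (e₁ e₂ : Fin 3 → ℝ) (a b α β : ℝ) : Prop :=
  ∃ θ : ℝ → ℝ, ContinuousOn θ (Set.Icc a b) ∧
    (∀ t ∈ Set.Icc a b, ∃ ξ : Fin 3 → ℝ, L t = Submodule.span ℝ {ξ} ∧
      ξ ⬝ᵥ e₁ = Real.cos (θ t) ∧ ξ ⬝ᵥ e₂ = Real.sin (θ t)) ∧ θ a = α ∧ θ b = β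

variable {L : ℝ → Submodule ℝ (Fin 3 → ℝ)} {e₁ e₂ : Fin 3 → ℝ} {a b c α β γ : ℝ}

theorem AngleOn.trans (hab : a ≤ b) (hbc : b ≤ c) (h1 : AngleOn L e₁ e₂ a b α β)
    (h2 : AngleOn L e₁ e₂ b c β γ) : AngleOn L e₁ e₂ a c α γ := by
  obtain ⟨θ, hθ, hL, ha, hb⟩ := h1
  obtain ⟨θ', hθ', hL', hb', hc'⟩ := h2
  have e1 : Set.EqOn (fun t => if t ≤ b then θ t else θ' t) θ (Set.Icc a b) := by
    intro t ht; exact if_pos ht.2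
  have e2 : Set.EqOn (fun t => if t ≤ b then θ t else θ' t) θ' (Set.Icc b c) := by
    intro t ht
    by_cases h : t ≤ b
    · have : t = b := le_antisymm h ht.1
      subst this
      simp [hb, hb']
    · exact if_neg h
  refine ⟨fun t => if t ≤ b then θ t else θ' t, ?_, ?_, ?_, ?_⟩
  · rw [← Set.Icc_union_Icc_eq_Icc hab hbc]
    exact (hθ.congr e1).union_of_isClosed (hθ'.congr e2) isClosed_Icc isClosed_Icc
  · intro t ht
    by_cases h : t ≤ b
    · simp only [if_pos h]; exact hL t ⟨ht.1, h⟩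
    · simp only [if_neg h]; exact hL' t ⟨(not_le.1 h).le, ht.2⟩
  · rw [← ha]; exact e1 ⟨le_rfl, hab⟩
  · rw [← hc']; exact e2 ⟨hbc, le_rfl⟩

/-- A line has no orientation, so its spanning vector may be reversed. This allows gluing of pieces
whose angles differ by π at the junction. -/
theorem AngleOn.add_pi (h : AngleOn L e₁ e₂ a b α β) :
    AngleOn L e₁ e₂ a b (α + Real.pi) (β + Real.pi) := by
  obtain ⟨θ, hθ, hL, rfl, rfl⟩ := h
  refine ⟨fun t => θ t + Real.pi, hθ.add continuousOn_const, ?_, rfl, rfl⟩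
  intro t ht
  obtain ⟨ξ, h1, h2, h3⟩ := hL t ht
  refine ⟨-ξ, ?_, ?_, ?_⟩
  · rw [h1, ← Set.neg_singleton, Submodule.span_neg]
  · rw [neg_dotProduct, h2, Real.cos_add_pi]
  · rw [neg_dotProduct, h3, Real.sin_add_pi]

theorem sq_div_sqrt_add_sq_div_sqrt {x y : ℝ} (h : 0 < x ^ 2 + y ^ 2) :
    (x / Real.sqrt (x ^ 2 + y ^ 2)) ^ 2 + (y / Real.sqrt (x ^ 2 + y ^ 2)) ^ 2 = 1 := by
  rw [div_pow, div_pow, Real.sq_sqrt h.le, ← add_div, div_self h.ne']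

theorem span_inv_smul_eq {s : ℝ} (hs : s ≠ 0) (ξ : Fin 3 → ℝ) :
    Submodule.span ℝ {ξ} = Submodule.span ℝ {s⁻¹ • ξ} :=
  (Submodule.span_singleton_smul_eq (IsUnit.mk0 _ (inv_ne_zero hs)) ξ).symm

/-- A vector field that stays in the open upper half plane, except for the ends of the path, turns
from the positive to the negative first axis. -/
theorem angleOn_zero_pi {ξ : ℝ → Fin 3 → ℝ} (hL : ∀ t ∈ Set.Icc a b, L t =
      Submodule.span ℝ {ξ t})
    (hx : ContinuousOn (fun t => ξ t ⬝ᵥ e₁) (Set.Icc a b))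
    (hy : ContinuousOn (fun t => ξ t ⬝ᵥ e₂) (Set.Icc a b))
    (hpos : ∀ t ∈ Set.Ioo a b, 0 < ξ t ⬝ᵥ e₂) (ha : ξ a ⬝ᵥ e₂ = 0) (hb : ξ b ⬝ᵥ e₂ = 0)
    (ha' : 0 < ξ a ⬝ᵥ e₁) (hb' : ξ b ⬝ᵥ e₁ < 0) : AngleOn L e₁ e₂ a b 0 Real.pi := by
  set x : ℝ → ℝ := fun t => ξ t ⬝ᵥ e₁ with hxd
  set y : ℝ → ℝ := fun t => ξ t ⬝ᵥ e₂ with hyd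
  have hya : y a = 0 := ha
  have hyb : y b = 0 := hb
  have hxa : 0 < x a := ha'
  have hxb : x b < 0 := hb'
  have hy0 : ∀ t ∈ Set.Icc a b, 0 ≤ y t := by
    intro t ht
    rcases eq_or_lt_of_le ht.1 with h | h
    · rw [← h, hya]
    rcases eq_or_lt_of_le ht.2 with h' | h'
    · rw [h', hyb]
    exact (hpos t ⟨h, h'⟩).le
  have hN : ∀ t ∈ Set.Icc a b, 0 < x t ^ 2 + y t ^ 2 := by
    intro t ht
    rcases eq_or_lt_of_le ht.1 with h | h
    · rw [← h]; positivity
    rcases eq_or_lt_of_le ht.2 with h' | h'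
    · rw [h']; have := mul_pos_of_neg_of_neg hxb hxb; nlinarith [sq_nonneg (y b)]
    have : 0 < y t := hpos t ⟨h, h'⟩
    positivity
  refine ⟨fun t => Real.arccos (x t / Real.sqrt (x t ^ 2 + y t ^ 2)), ?_, ?_, ?_, ?_⟩
  · refine Real.continuous_arccos.comp_continuousOn (hx.div ?_ ?_)
    · exact ((hx.pow 2).add (hy.pow 2)).sqrt
    · intro t ht; exact (Real.sqrt_pos.2 (hN t ht)).ne'
  · intro t ht
    have hs := Real.sqrt_pos.2 (hN t ht)
    have h1 := sq_div_sqrt_add_sq_div_sqrt (hN t ht)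
    have habs := abs_le_one_iff_mul_self_le_one.2
      (by nlinarith [sq_nonneg (y t / Real.sqrt (x t ^ 2 + y t ^ 2))] :
        x t / Real.sqrt (x t ^ 2 + y t ^ 2) * (x t / Real.sqrt (x t ^ 2 + y t ^ 2)) ≤ 1)
    refine ⟨(Real.sqrt (x t ^ 2 + y t ^ 2))⁻¹ • ξ t, ?_, ?_, ?_⟩
    · rw [hL t ht]; exact span_inv_smul_eq hs.ne' _
    · rw [Real.cos_arccos (abs_le.1 habs).1 (abs_le.1 habs).2, smul_dotProduct, smul_eq_mul,
        div_eq_inv_mul]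
    · rw [Real.sin_arccos, ← eq_sub_of_add_eq' h1, Real.sqrt_sq (div_nonneg (hy0 t ht) hs.le),
        smul_dotProduct, smul_eq_mul, div_eq_inv_mul]
  · simp only [hya]
    rw [zero_pow two_ne_zero, add_zero, Real.sqrt_sq hxa.le, div_self hxa.ne', Real.arccos_one]
  · simp only [hyb]
    rw [zero_pow two_ne_zero, add_zero, Real.sqrt_sq_eq_abs, abs_of_neg hxb, div_neg,
      div_self hxb.ne, Real.arccos_neg_one]

/-- A vector field that stays in the open right half plane, and has the direction of the first axis
at the ends of the path, does not turn. -/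
theorem angleOn_zero_zero {ξ : ℝ → Fin 3 → ℝ}
    (hL : ∀ t ∈ Set.Icc a b, L t = Submodule.span ℝ {ξ t})
    (hx : ContinuousOn (fun t => ξ t ⬝ᵥ e₁) (Set.Icc a b))
    (hy : ContinuousOn (fun t => ξ t ⬝ᵥ e₂) (Set.Icc a b))
    (hpos : ∀ t ∈ Set.Icc a b, 0 < ξ t ⬝ᵥ e₁) (ha : ξ a ⬝ᵥ e₂ = 0) (hb : ξ b ⬝ᵥ e₂ = 0) :
    AngleOn L e₁ e₂ a b 0 0 := by
  set x : ℝ → ℝ := fun t => ξ t ⬝ᵥ e₁ with hxd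
  set y : ℝ → ℝ := fun t => ξ t ⬝ᵥ e₂ with hyd
  have hya : y a = 0 := ha
  have hyb : y b = 0 := hb
  have hN : ∀ t ∈ Set.Icc a b, 0 < x t ^ 2 + y t ^ 2 := by
    intro t ht
    have : 0 < x t := hpos t ht
    positivity
  refine ⟨fun t => Real.arcsin (y t / Real.sqrt (x t ^ 2 + y t ^ 2)), ?_, ?_, ?_, ?_⟩
  · refine Real.continuous_arcsin.comp_continuousOn (hy.div ?_ ?_)
    · exact ((hx.pow 2).add (hy.pow 2)).sqrt
    · intro t ht; exact (Real.sqrt_pos.2 (hN t ht)).ne'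
  · intro t ht
    have hs := Real.sqrt_pos.2 (hN t ht)
    have h1 := sq_div_sqrt_add_sq_div_sqrt (hN t ht)
    have habs := abs_le_one_iff_mul_self_le_one.2
      (by nlinarith [sq_nonneg (x t / Real.sqrt (x t ^ 2 + y t ^ 2))] :
        y t / Real.sqrt (x t ^ 2 + y t ^ 2) * (y t / Real.sqrt (x t ^ 2 + y t ^ 2)) ≤ 1)
    refine ⟨(Real.sqrt (x t ^ 2 + y t ^ 2))⁻¹ • ξ t, ?_, ?_, ?_⟩
    · rw [hL t ht]; exact span_inv_smul_eq hs.ne' _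
    · rw [Real.cos_arcsin, ← eq_sub_of_add_eq h1,
        Real.sqrt_sq (div_nonneg (hpos t ht).le hs.le), smul_dotProduct, smul_eq_mul,
        div_eq_inv_mul]
    · rw [Real.sin_arcsin (abs_le.1 habs).1 (abs_le.1 habs).2, smul_dotProduct, smul_eq_mul,
        div_eq_inv_mul]
  · simp only [hya]
    rw [zero_div, Real.arcsin_zero]
  · simp only [hyb]
    rw [zero_div, Real.arcsin_zero]


end Angle

/-! ### The two null directions near a zero of the top form -/

section Frame

variable (f : MvPolynomial (Fin 2) ℝ) (c : Fin 2 → ℝ) (σ : ℝ) (q : Fin 3 → ℝ)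

/-- The direction of the equator at the point `(c 0, c 1, 0)`. -/
def equatorDir : Fin 3 → ℝ := ![-c 1, c 0, 0]

/-- The direction of the meridians at the equator. -/
def poleDir : Fin 3 → ℝ := ![0, 0, 1]

/-- The coordinate of `q` along `(c 0, c 1, 0)`. -/
def radialCoord : ℝ := q 0 * c 0 + q 1 * c 1

/-- The coordinate of `q` along the equator. -/
def equatorCoord : ℝ := -(q 0 * c 1) + q 1 * c 0

/-- The second derivative of `F` along the equator. -/
def coeffA : ℝ :=
  c 1 ^ 2 * eval q (pderiv 0 (pderiv 0 (homForm f))) -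
    2 * c 0 * c 1 * eval q (pderiv 0 (pderiv 1 (homForm f))) +
    c 0 ^ 2 * eval q (pderiv 1 (pderiv 1 (homForm f)))

/-- The mixed coefficient of the extended form, divided by `ω`. -/
def coeffB : ℝ :=
  -c 1 * (-q 0 * eval q (pderiv 0 (pderiv 0 (homForm f))) -
      q 1 * eval q (pderiv 0 (pderiv 1 (homForm f)))) +
    c 0 * (-q 0 * eval q (pderiv 0 (pderiv 1 (homForm f))) -
      q 1 * eval q (pderiv 1 (pderiv 1 (homForm f))))

/-- The coefficient of `dω²`. -/
def coeffS : ℝ :=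
  q 0 ^ 2 * eval q (pderiv 0 (pderiv 0 (homForm f))) +
    2 * q 0 * q 1 * eval q (pderiv 0 (pderiv 1 (homForm f))) +
    q 1 ^ 2 * eval q (pderiv 1 (pderiv 1 (homForm f)))

/-- The root of larger modulus of `T² - 2 B T + A S`. -/
def coeffK : ℝ := coeffB f c q + σ * (radialCoord c q * Real.sqrt (-eval q (hessForm f)))

/-- A vector on the line of the null direction that has a node at the equator. -/
def nodeVec : Fin 3 → ℝ :=
  tangentVec q (equatorDir c) poleDir (-(coeffS f q / coeffK f c σ q)) (q 2)

/-- A vector on the line of the null direction that is regular at the equator. -/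
def regularVec : Fin 3 → ℝ :=
  tangentVec q (equatorDir c) poleDir 1 (-(q 2 * coeffA f c q / coeffK f c σ q))

/-- The derivative quotient of the top form along the equator at `(c 0, c 1)`. -/
def topQuotient : Polynomial ℝ := (restrictLine (topForm f) c ![-c 1, c 0]).divX

/-- The properties of the points close to a singular point at infinity that determine the index. -/
structure IsNear : Prop where
  radial : 0 < radialCoord c q
  hess_neg : eval q (hessForm f) < 0
  coeffB_pos : 0 < σ * coeffB f c q
  node_pos : 0 < 1 - q 2 ^ 2 + equatorCoord c q * (coeffS f q / coeffK f c σ q)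
  regular_pos : 0 < 1 - (equatorCoord c q - q 2 * (q 2 * coeffA f c q / coeffK f c σ q)) *
    equatorCoord c q
  top_pos : 0 < -σ * (topQuotient f c).eval (equatorCoord c q / radialCoord c q)

variable {f c σ q}

theorem dotProduct_equatorDir : q ⬝ᵥ equatorDir c = equatorCoord c q := by
  rw [dotProduct_three]; simp [equatorDir, equatorCoord]

theorem dotProduct_poleDir : q ⬝ᵥ poleDir = q 2 := by
  rw [dotProduct_three]; simp [poleDir]

theorem tangentVec_dotProduct_equatorDir (hc : c 0 ^ 2 + c 1 ^ 2 = 1) (X Y : ℝ) :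
    tangentVec q (equatorDir c) poleDir X Y ⬝ᵥ equatorDir c =
      X - (X * equatorCoord c q + Y * q 2) * equatorCoord c q := by
  rw [tangentVec, sub_dotProduct, add_dotProduct, smul_dotProduct, smul_dotProduct,
    smul_dotProduct, dotProduct_equatorDir, dotProduct_equatorDir, dotProduct_equatorDir,
    dotProduct_poleDir]
  simp only [equatorCoord, equatorDir, poleDir, smul_eq_mul]
  simp
  linear_combination X * hc

theorem tangentVec_dotProduct_poleDir (X Y : ℝ) :
    tangentVec q (equatorDir c) poleDir X Y ⬝ᵥ poleDir =
      Y - (X * equatorCoord c q + Y * q 2) * q 2 := by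
  rw [dotProduct_poleDir, tangentVec, dotProduct_equatorDir, dotProduct_poleDir]
  simp [equatorDir, poleDir]

/-- A, -B and S are the entries of the Hessian of F in u, v on the pair (-c₁, c₀), (q₀, q₁), whose
determinant is, up to sign, the radial coordinate. -/
theorem coeff_discriminant (hn : 2 ≤ f.totalDegree) :
    coeffB f c q ^ 2 - coeffA f c q * coeffS f q =
      -eval q (hessForm f) * radialCoord c q ^ 2 := by
  rw [hessForm_eq hn]
  simp only [coeffA, coeffB, coeffS, radialCoord, map_sub, map_mul, map_pow]
  ring

theorem IsNear.coeffK_pos (h : IsNear f c σ q) (hσ : σ ^ 2 = 1) : 0 < σ * coeffK f c σ q := by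
  have h1 := h.coeffB_pos
  have h2 : 0 ≤ radialCoord c q * Real.sqrt (-eval q (hessForm f)) :=
    mul_nonneg h.radial.le (Real.sqrt_nonneg _)
  rw [coeffK, mul_add, ← mul_assoc, ← pow_two, hσ, one_mul]
  linarith

theorem IsNear.coeffK_ne_zero (h : IsNear f c σ q) (hσ : σ ^ 2 = 1) : coeffK f c σ q ≠ 0 := by
  intro h0
  have := h.coeffK_pos hσ
  rw [h0, mul_zero] at this
  exact lt_irrefl _ this

/-- The product of the two roots of T² - 2BT + AS. -/
theorem coeffK_mul (hn : 2 ≤ f.totalDegree) (h : IsNear f c σ q) (hσ : σ ^ 2 = 1) :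
    (coeffB f c q - σ * (radialCoord c q * Real.sqrt (-eval q (hessForm f)))) *
      coeffK f c σ q = coeffA f c q * coeffS f q := by
  have h1 := coeff_discriminant (c := c) (q := q) hn
  have h2 : Real.sqrt (-eval q (hessForm f)) ^ 2 = -eval q (hessForm f) :=
    Real.sq_sqrt (by linarith [h.hess_neg])
  rw [coeffK]
  linear_combination h1 - radialCoord c q ^ 2 * σ ^ 2 * h2 +
    radialCoord c q ^ 2 * eval q (hessForm f) * hσ

theorem frame_coefficients :
    q ⬝ᵥ crossProduct (equatorDir c) poleDir = radialCoord c q ∧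
    equatorDir c ⬝ᵥ (extForm f q).mulVec (equatorDir c) = q 2 ^ 2 * coeffA f c q ∧
    equatorDir c ⬝ᵥ (extForm f q).mulVec poleDir = q 2 * coeffB f c q ∧
    poleDir ⬝ᵥ (extForm f q).mulVec poleDir = coeffS f q := by
  refine ⟨?_, ?_, ?_, ?_⟩
  · simp only [dotProduct_three, cross_apply]
    simp [equatorDir, poleDir, radialCoord]
  · simp only [Matrix.mulVec, dotProduct_three]
    simp [extForm, equatorDir, coeffA]
    ring
  · simp only [Matrix.mulVec, dotProduct_three]
    simp [extForm, equatorDir, poleDir, coeffB]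
    ring
  · simp only [Matrix.mulVec, dotProduct_three]
    simp [extForm, poleDir, coeffS]

/-- The absolute value makes the fields exchange their type across the equator: (-1)^k |ω| is σω on
one side and -σω on the other. -/
theorem sqrt_disc (q : Fin 3 → ℝ) :
    Real.sqrt (disc f q) = |q 2| * Real.sqrt (-eval q (hessForm f)) := by
  rw [disc, ← mul_neg, Real.sqrt_mul (sq_nonneg _), Real.sqrt_sq_eq_abs]

/-- For this sign the second eigen-equation is ωK X + S Y = 0. Dividing by K instead of ω keeps the
solution (-S/K, ω) continuous across the equator. -/
theorem lineField_eq_span_nodeVec (hn : 2 ≤ f.totalDegree)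
    (hσ : σ ^ 2 = 1) (hq : q ⬝ᵥ q = 1) (h : IsNear f c σ q) {k : ℕ}
    (hk : (-1) ^ k * |q 2| = σ * q 2) (hne : q 2 ≠ 0 ∨ coeffS f q ≠ 0) :
    lineField f k q = Submodule.span ℝ {nodeVec f c σ q} := by
  obtain ⟨hδ, hα, hβ, hγ⟩ := frame_coefficients (f := f) (c := c) (q := q)
  have hK := h.coeffK_ne_zero hσ
  have hKm := coeffK_mul hn h hσ
  have hl : (-1) ^ k * Real.sqrt (disc f q) =
      σ * q 2 * Real.sqrt (-eval q (hessForm f)) := by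
    rw [sqrt_disc, ← mul_assoc, hk]
  have hp : q 2 * coeffB f c q + σ * q 2 * Real.sqrt (-eval q (hessForm f)) * radialCoord c q =
      q 2 * coeffK f c σ q := by rw [coeffK]; ring
  refine lineField_eq_span hq h.radial.ne' hδ hl hα hβ hγ ?_ ?_ ?_ ?_
  · rcases hne with h0 | h0
    · exact Or.inr h0
    · exact Or.inl (neg_ne_zero.2 (div_ne_zero h0 hK))
  · field_simp
    linear_combination q 2 ^ 2 * hKm
  · rw [hp]; field_simp; ring
  · rw [hp]
    rcases hne with h0 | h0
    · exact Or.inr (Or.inl (mul_ne_zero h0 hK))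
    · exact Or.inr (Or.inr h0)

/-- For the opposite sign the first eigen-equation is ω²A X + ωK Y = 0, solved by (1, -ωA/K). -/
theorem lineField_eq_span_regularVec (hn : 2 ≤ f.totalDegree)
    (hσ : σ ^ 2 = 1) (hq : q ⬝ᵥ q = 1) (h : IsNear f c σ q) {k : ℕ}
    (hk : (-1) ^ k * |q 2| = -σ * q 2) (hne : q 2 ≠ 0 ∨ coeffS f q ≠ 0) :
    lineField f k q = Submodule.span ℝ {regularVec f c σ q} := by
  obtain ⟨hδ, hα, hβ, hγ⟩ := frame_coefficients (f := f) (c := c) (q := q)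
  have hK := h.coeffK_ne_zero hσ
  have hKm := coeffK_mul hn h hσ
  have hl : (-1) ^ k * Real.sqrt (disc f q) =
      -σ * q 2 * Real.sqrt (-eval q (hessForm f)) := by
    rw [sqrt_disc, ← mul_assoc, hk]
  have hp : q 2 * coeffB f c q - -σ * q 2 * Real.sqrt (-eval q (hessForm f)) * radialCoord c q =
      q 2 * coeffK f c σ q := by rw [coeffK]; ring
  refine lineField_eq_span hq h.radial.ne' hδ hl hα hβ hγ (Or.inl one_ne_zero) ?_ ?_ ?_
  · rw [hp]; field_simp; ring
  · field_simp
    linear_combination q 2 * hKm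
  · rw [hp]
    rcases hne with h0 | h0
    · exact Or.inl (Or.inr (mul_ne_zero h0 hK))
    · exact Or.inr (Or.inr h0)

theorem coeffS_of_equator (hn : 2 ≤ f.totalDegree) (hq : q 2 = 0) :
    coeffS f q = f.totalDegree * (f.totalDegree - 1) * eval ![q 0, q 1] (topForm f) := by
  have e00 := eval_pderiv_homForm_of_eq_zero f 0 0 hq
  have e01 := eval_pderiv_homForm_of_eq_zero f 0 1 hq
  have e11 := eval_pderiv_homForm_of_eq_zero f 1 1 hq
  simp only [Fin.castSucc_zero, Fin.castSucc_one] at e00 e01 e11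
  rw [← euler_second (topForm_isHomogeneous f) (by omega), coeffS, e00, e01, e11]
  rfl

/-- On the equator S is a positive multiple of ν times the value of `topQuotient`, whose sign is
opposite to that of K. So the node vector points away from the singular point. -/
theorem IsNear.node_direction (h : IsNear f c σ q) (hn : 2 ≤ f.totalDegree)
    (hc : c 0 ^ 2 + c 1 ^ 2 = 1) (hσ : σ ^ 2 = 1) (hzero : eval c (topForm f) = 0)
    (hq : q 2 = 0) (hν : equatorCoord c q ≠ 0) :
    0 < -(coeffS f q / coeffK f c σ q) * equatorCoord c q := by
  set s := radialCoord c q with hs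
  set ν := equatorCoord c q with hνd
  have hs0 := h.radial
  have hx : (![q 0, q 1] : Fin 2 → ℝ) = s • (c + (ν / s) • ![-c 1, c 0]) := by
    rw [smul_add, smul_smul, mul_div_cancel₀ _ hs0.ne']
    ext i
    fin_cases i
    · simp [hs, hνd, radialCoord, equatorCoord]; linear_combination -q 0 * hc
    · simp [hs, hνd, radialCoord, equatorCoord]; linear_combination -q 1 * hc
  have hR : (restrictLine (topForm f) c ![-c 1, c 0]).eval (ν / s) =
      (topQuotient f c).eval (ν / s) * (ν / s) := by
    conv_lhs => rw [← Polynomial.divX_mul_X_add (restrictLine (topForm f) c ![-c 1, c 0])]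
    rw [(coeff_restrictLine_two (topForm f) c ![-c 1, c 0]).1, hzero]
    simp [topQuotient]
  rw [coeffS_of_equator hn hq, hx, eval_smul_of_isHomogeneous (topForm_isHomogeneous f),
    ← eval_restrictLine, hR]
  have hK := h.coeffK_pos hσ
  have hK0 := h.coeffK_ne_zero hσ
  have ht := h.top_pos
  have h2 : (2 : ℝ) ≤ f.totalDegree := by exact_mod_cast hn
  have hnn : (0 : ℝ) < f.totalDegree * (f.totalDegree - 1) := mul_pos (by linarith) (by linarith)
  have hpow := pow_pos hs0 f.totalDegree
  have hid : -((f.totalDegree : ℝ) * (f.totalDegree - 1) * (s ^ f.totalDegree *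
      ((topQuotient f c).eval (ν / s) * (ν / s))) / coeffK f c σ q) * ν =
      (f.totalDegree * (f.totalDegree - 1)) * s ^ f.totalDegree *
        (-σ * (topQuotient f c).eval (ν / s)) * (ν ^ 2 / s) / (σ * coeffK f c σ q) := by
    have hσ0 : σ ≠ 0 := by rintro rfl; simp at hσ
    field_simp
  rw [hid]
  have hν2 : 0 < ν ^ 2 := by positivity
  positivity

end Frame


/-! ### Validity of the local picture on small circles -/

section Index

open Filter Topology

variable {f : MvPolynomial (Fin 2) ℝ} {c : Fin 2 → ℝ} {σ : ℝ}

theorem continuous_radialCoord : Continuous (radialCoord c) := by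
  unfold radialCoord; fun_prop

theorem continuous_equatorCoord : Continuous (equatorCoord c) := by
  unfold equatorCoord; fun_prop

theorem continuous_coeffA : Continuous (coeffA f c) := by
  have := fun g : MvPolynomial (Fin 3) ℝ => MvPolynomial.continuous_eval g
  unfold coeffA; fun_prop

theorem continuous_coeffB : Continuous (coeffB f c) := by
  have := fun g : MvPolynomial (Fin 3) ℝ => MvPolynomial.continuous_eval g
  unfold coeffB; fun_prop

theorem continuous_coeffS : Continuous (coeffS f) := by
  have := fun g : MvPolynomial (Fin 3) ℝ => MvPolynomial.continuous_eval g
  unfold coeffS; fun_prop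

theorem continuous_coeffK : Continuous (coeffK f c σ) := by
  have h1 := MvPolynomial.continuous_eval (hessForm f)
  have h2 := continuous_coeffB (f := f) (c := c)
  have h3 := continuous_radialCoord (c := c)
  unfold coeffK; fun_prop

/-- At a zero of the squarefree top form, the tangential derivative does not vanish. -/
theorem tangential_derivative_ne_zero (hsq : Squarefree (topForm f))
    (hc : c 0 ^ 2 + c 1 ^ 2 = 1) (hzero : eval c (topForm f) = 0) :
    -c 1 * eval c (pderiv 0 (topForm f)) + c 0 * eval c (pderiv 1 (topForm f)) ≠ 0 := by
  intro h
  have heu := euler_two (topForm_isHomogeneous f) c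
  rw [hzero, mul_zero] at heu
  refine gradient_ne_zero_of_squarefree (topForm_isHomogeneous f) hsq (z := c) ?_ ?_ ?_ hzero
  · rintro rfl; simp at hc
  · linear_combination -eval c (pderiv 0 (topForm f)) * hc + c 0 * heu - c 1 * h
  · linear_combination -eval c (pderiv 1 (topForm f)) * hc + c 1 * heu + c 0 * h

/-- All conditions are strict inequalities between functions continuous at the point, so they need
checking only there: ν = ω = S = 0, s = 1, B = -(n-1)κ, and the quotient of f_n takes the value κ ≠
0. The sign σ is that of -κ. -/
theorem exists_eventually_isNear (hn : 2 ≤ f.totalDegree) (hsq : Squarefree (topForm f))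
    (hc : c 0 ^ 2 + c 1 ^ 2 = 1) (hzero : eval c (topForm f) = 0) :
    ∃ σ : ℝ, σ ^ 2 = 1 ∧ ∀ᶠ q in 𝓝 (![c 0, c 1, 0] : Fin 3 → ℝ), IsNear f c σ q := by
  set p : Fin 3 → ℝ := ![c 0, c 1, 0] with hp
  have hp2 : p 2 = 0 := by simp [hp]
  have hcp : (![p 0, p 1] : Fin 2 → ℝ) = c := by ext i; fin_cases i <;> simp [hp]
  set κ := -c 1 * eval c (pderiv 0 (topForm f)) + c 0 * eval c (pderiv 1 (topForm f)) with hκ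
  have hκ0 : κ ≠ 0 := tangential_derivative_ne_zero hsq hc hzero
  have h2 : (2 : ℝ) ≤ f.totalDegree := by exact_mod_cast hn
  have vr : radialCoord c p = 1 := by simp [radialCoord, hp]; linarith
  have vν : equatorCoord c p = 0 := by simp [equatorCoord, hp]; ring
  have vS : coeffS f p = 0 := by rw [coeffS_of_equator hn hp2, hcp, hzero, mul_zero]
  have vB : coeffB f c p = -((f.totalDegree - 1) * κ) := by
    have e00 := eval_pderiv_homForm_of_eq_zero f 0 0 hp2
    have e01 := eval_pderiv_homForm_of_eq_zero f 0 1 hp2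
    have e11 := eval_pderiv_homForm_of_eq_zero f 1 1 hp2
    simp only [Fin.castSucc_zero, Fin.castSucc_one, hcp] at e00 e01 e11
    have e0 := euler_two ((topForm_isHomogeneous f).pderiv (i := 0)) c
    have e1 := euler_two ((topForm_isHomogeneous f).pderiv (i := 1)) c
    rw [pderiv_comm 1 0] at e0
    have hcast : ((f.totalDegree - 1 : ℕ) : ℝ) = f.totalDegree - 1 := by
      rw [Nat.cast_sub (by omega)]; simp
    rw [hcast] at e0 e1
    rw [coeffB, e00, e01, e11, hκ]
    simp only [hp, Matrix.cons_val_zero, Matrix.cons_val_one]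
    linear_combination c 1 * e0 - c 0 * e1
  have vT : (topQuotient f c).eval 0 = κ := by
    rw [← Polynomial.coeff_zero_eq_eval_zero, topQuotient, Polynomial.coeff_divX,
      (coeff_restrictLine_two (topForm f) c ![-c 1, c 0]).2.1]
    simp [hκ]
  -- Since S = 0 and s = 1, the discriminant identity reads B² = -H_f.
  have vH : eval p (hessForm f) < 0 := by
    have := coeff_discriminant (c := c) (q := p) hn
    rw [vS, vr, vB] at this
    have h3 : 0 < ((f.totalDegree - 1) * κ) ^ 2 := by
      have : (f.totalDegree - 1 : ℝ) * κ ≠ 0 := mul_ne_zero (by linarith) hκ0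
      positivity
    linarith
  obtain ⟨σ, hσ, hσκ⟩ : ∃ σ : ℝ, σ ^ 2 = 1 ∧ 0 < -σ * κ := by
    rcases lt_or_gt_of_ne hκ0 with h | h
    · exact ⟨1, by norm_num, by linarith⟩
    · exact ⟨-1, by norm_num, by linarith⟩
  refine ⟨σ, hσ, ?_⟩
  have vσB : 0 < σ * coeffB f c p := by
    rw [vB]
    have := mul_pos (show (0 : ℝ) < f.totalDegree - 1 by linarith) hσκ
    linarith
  have vK : coeffK f c σ p ≠ 0 := by
    intro h0
    have h1 : 0 ≤ radialCoord c p * Real.sqrt (-eval p (hessForm f)) := by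
      rw [vr]; positivity
    have : 0 < σ * coeffK f c σ p := by
      rw [coeffK, mul_add, ← mul_assoc, ← pow_two, hσ, one_mul]; linarith
    rw [h0, mul_zero] at this
    exact lt_irrefl _ this
  have cr := (continuous_radialCoord (c := c)).continuousAt (x := p)
  have cν := (continuous_equatorCoord (c := c)).continuousAt (x := p)
  have cA := (continuous_coeffA (f := f) (c := c)).continuousAt (x := p)
  have cB := (continuous_coeffB (f := f) (c := c)).continuousAt (x := p)
  have cS := (continuous_coeffS (f := f)).continuousAt (x := p)
  have cK := (continuous_coeffK (f := f) (c := c) (σ := σ)).continuousAt (x := p)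
  have cH := (MvPolynomial.continuous_eval (hessForm f)).continuousAt (x := p)
  have cw : ContinuousAt (fun q : Fin 3 → ℝ => q 2) p := (continuous_apply 2).continuousAt
  have cSK := cS.div cK vK
  have cAK := (cw.mul cA).div cK vK
  have c4 := ((continuousAt_const (y := (1 : ℝ))).sub (cw.pow 2)).add (cν.mul cSK)
  have c5 := (continuousAt_const (y := (1 : ℝ))).sub ((cν.sub (cw.mul cAK)).mul cν)
  have c6 := (continuousAt_const (y := -σ)).mul
    ((topQuotient f c).continuous.continuousAt.comp (cν.div cr (by rw [vr]; exact one_ne_zero)))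
  filter_upwards [cr.tendsto.eventually (lt_mem_nhds (show 0 < radialCoord c p by rw [vr]; norm_num)),
    cH.tendsto.eventually (gt_mem_nhds vH),
    (continuousAt_const.mul cB).tendsto.eventually (lt_mem_nhds vσB),
    c4.tendsto.eventually (lt_mem_nhds (a := 0) (by simp [vν, hp2])),
    c5.tendsto.eventually (lt_mem_nhds (a := 0) (by simp [vν])),
    c6.tendsto.eventually (lt_mem_nhds (a := 0) (by simp [vν, vT]; linarith))]
    with q h1 h2 h3 h4 h5 h6
  exact ⟨h1, h2, h3, h4, h5, h6⟩

/-- The circle of radius `r` around `(c 0, c 1, 0)`, in the chart of the orthogonal projection. -/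
def circlePath (c : Fin 2 → ℝ) (r t : ℝ) : Fin 3 → ℝ :=
  Real.sqrt (1 - r ^ 2) • ![c 0, c 1, 0] + (r * Real.cos t) • equatorDir c +
    (r * Real.sin t) • poleDir

theorem continuous_circlePath (r : ℝ) : Continuous (circlePath c r) := by
  unfold circlePath; fun_prop

theorem circlePath_coords (hc : c 0 ^ 2 + c 1 ^ 2 = 1) (r t : ℝ) :
    equatorCoord c (circlePath c r t) = r * Real.cos t ∧
      circlePath c r t 2 = r * Real.sin t := by
  refine ⟨?_, ?_⟩
  · simp [equatorCoord, circlePath, equatorDir, poleDir]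
    linear_combination r * Real.cos t * hc
  · simp [circlePath, equatorDir, poleDir]

theorem circlePath_unit (hc : c 0 ^ 2 + c 1 ^ 2 = 1) {r : ℝ} (hr : r ^ 2 ≤ 1) (t : ℝ) :
    circlePath c r t ⬝ᵥ circlePath c r t = 1 := by
  have hs := Real.sq_sqrt (show 0 ≤ 1 - r ^ 2 by linarith)
  have ht := Real.sin_sq_add_cos_sq t
  rw [dotProduct_three]
  simp [circlePath, equatorDir, poleDir]
  linear_combination (Real.sqrt (1 - r ^ 2) ^ 2 + (r * Real.cos t) ^ 2) * hc + hs + r ^ 2 * ht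

theorem dist_circlePath_lt (hc : c 0 ^ 2 + c 1 ^ 2 = 1) {r ρ : ℝ} (hr0 : 0 < r) (hr1 : r ≤ 1)
    (hr : r * 2 < ρ) (t : ℝ) : dist (circlePath c r t) ![c 0, c 1, 0] < ρ := by
  have hs0 : 1 - r ≤ Real.sqrt (1 - r ^ 2) := Real.le_sqrt_of_sq_le (by nlinarith)
  have hs1 : Real.sqrt (1 - r ^ 2) ≤ 1 := Real.sqrt_le_one.2 (by nlinarith)
  have hc0 : |c 0| ≤ 1 := abs_le_one_iff_mul_self_le_one.2 (by nlinarith [sq_nonneg (c 1)])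
  have hc1 : |c 1| ≤ 1 := abs_le_one_iff_mul_self_le_one.2 (by nlinarith [sq_nonneg (c 0)])
  have hcos := Real.abs_cos_le_one t
  have hsin := Real.abs_sin_le_one t
  have hs : |Real.sqrt (1 - r ^ 2) - 1| ≤ r := by rw [abs_le]; constructor <;> linarith
  have hprod : ∀ x y : ℝ, |x| ≤ 1 → |y| ≤ 1 → |x * y| ≤ 1 := fun x y hx hy => by
    rw [abs_mul]; exact mul_le_one₀ hx (abs_nonneg y) hy
  have hcomb : ∀ x y : ℝ, |x| ≤ 1 → |y| ≤ 1 →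
      |(Real.sqrt (1 - r ^ 2) - 1) * x + r * y| ≤ r * 2 := fun x y hx hy => by
    refine (abs_add_le _ _).trans ?_
    rw [abs_mul, abs_mul, abs_of_pos hr0]
    have := mul_le_mul hs hx (abs_nonneg x) hr0.le
    have := mul_le_mul_of_nonneg_left hy hr0.le
    linarith
  rw [dist_pi_lt_iff (by linarith)]
  intro i
  rw [Real.dist_eq]
  fin_cases i
  · simp [circlePath, equatorDir, poleDir]
    have := hcomb (c 0) (-(Real.cos t * c 1)) hc0 (by rw [abs_neg]; exact hprod _ _ hcos hc1)
    refine lt_of_le_of_lt (le_of_eq ?_) (this.trans_lt hr)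
    congr 1; ring
  · simp [circlePath, equatorDir, poleDir]
    have := hcomb (c 1) (Real.cos t * c 0) hc1 (hprod _ _ hcos hc0)
    refine lt_of_le_of_lt (le_of_eq ?_) (this.trans_lt hr)
    congr 1; ring
  · simp [circlePath, equatorDir, poleDir]
    rw [abs_of_pos hr0]
    nlinarith

end Index


/-! ### The index at a zero of the top form -/

section Index

variable {f : MvPolynomial (Fin 2) ℝ} {c : Fin 2 → ℝ} {σ : ℝ}

theorem IsNear.coeffS_ne_zero_or {q : Fin 3 → ℝ} (h : IsNear f c σ q) (hn : 2 ≤ f.totalDegree)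
    (hc : c 0 ^ 2 + c 1 ^ 2 = 1) (hσ : σ ^ 2 = 1) (hzero : eval c (topForm f) = 0)
    (hν : equatorCoord c q ≠ 0 ∨ q 2 ≠ 0) : q 2 ≠ 0 ∨ coeffS f q ≠ 0 := by
  by_cases hq : q 2 = 0
  · refine Or.inr fun h0 => ?_
    have := h.node_direction hn hc hσ hzero hq (hν.resolve_right (not_not.2 hq))
    rw [h0] at this
    simp at this
  · exact Or.inl hq

theorem neg_one_pow_eq_or_eq_neg (k : ℕ) (hσ : σ ^ 2 = 1) :
    ((-1 : ℝ) ^ k = σ) ∨ ((-1 : ℝ) ^ k = -σ) := by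
  rcases neg_one_pow_eq_or ℝ k with h | h <;> rcases sq_eq_one_iff.1 hσ with h' | h' <;>
    rw [h, h'] <;> norm_num

/-- The circle is cut at its two points on the equator. On the half where the node vector spans the
field, the angle grows by π; on the other half the regular vector keeps a positive first component
and is tangent to the equator at both ends, so the angle does not change. Whether (-1)^k is σ or -σ
only exchanges the halves. -/
theorem hasPoincareIndex_half (hn : 2 ≤ f.totalDegree) (hsq : Squarefree (topForm f))
    (hc : c 0 ^ 2 + c 1 ^ 2 = 1) (hzero : eval c (topForm f) = 0) (k : ℕ) :
    HasPoincareIndex (lineField f k) ![c 0, c 1, 0] (1 / 2) := by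
  obtain ⟨σ, hσ, hev⟩ := exists_eventually_isNear hn hsq hc hzero
  obtain ⟨ρ, hρ, hball⟩ := Metric.eventually_nhds_iff.1 hev
  refine ⟨equatorDir c, poleDir, ?_, ?_, ?_, ?_, ?_, ?_, min 1 (ρ / 2),
    lt_min one_pos (half_pos hρ), min_le_left _ _, ?_⟩
  · rw [dotProduct_three]; simp; linarith
  · rw [dotProduct_three]; simp [equatorDir]; linarith
  · rw [dotProduct_three]; simp [poleDir]
  · rw [dotProduct_three]; simp [equatorDir]; ring
  · rw [dotProduct_three]; simp [poleDir]
  · rw [dotProduct_three]; simp [poleDir, equatorDir]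
  intro r hr0 hr
  have hr1 : r < 1 := hr.trans_le (min_le_left _ _)
  have hr2 : r * 2 < ρ := by have := hr.trans_le (min_le_right _ _); linarith
  have hrsq : r ^ 2 < 1 := by nlinarith
  have near : ∀ t, IsNear f c σ (circlePath c r t) := fun t =>
    hball (dist_circlePath_lt hc hr0 hr1.le hr2 t)
  have unit : ∀ t, circlePath c r t ⬝ᵥ circlePath c r t = 1 := circlePath_unit hc hrsq.le
  have hν : ∀ t, equatorCoord c (circlePath c r t) = r * Real.cos t := fun t =>
    (circlePath_coords hc r t).1
  have hw : ∀ t, circlePath c r t 2 = r * Real.sin t := fun t => (circlePath_coords hc r t).2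
  have hK : ∀ t, coeffK f c σ (circlePath c r t) ≠ 0 := fun t => (near t).coeffK_ne_zero hσ
  have hne : ∀ t, circlePath c r t 2 ≠ 0 ∨ coeffS f (circlePath c r t) ≠ 0 := by
    intro t
    refine (near t).coeffS_ne_zero_or hn hc hσ hzero ?_
    rw [hν, hw]
    by_contra hcon
    push Not at hcon
    have h1 := (mul_eq_zero.1 hcon.1).resolve_left hr0.ne'
    have h2 := (mul_eq_zero.1 hcon.2).resolve_left hr0.ne'
    have := Real.sin_sq_add_cos_sq t
    rw [h1, h2] at this
    norm_num at this
  set N : ℝ → Fin 3 → ℝ := fun t => nodeVec f c σ (circlePath c r t) with hN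
  set G : ℝ → Fin 3 → ℝ := fun t => regularVec f c σ (circlePath c r t) with hG
  set x : ℝ → ℝ := fun t => -(coeffS f (circlePath c r t) / coeffK f c σ (circlePath c r t)) with hx
  set y : ℝ → ℝ := fun t => -(circlePath c r t 2 * coeffA f c (circlePath c r t) /
    coeffK f c σ (circlePath c r t)) with hy
  have hN1 : ∀ t, N t ⬝ᵥ equatorDir c =
      x t - (x t * (r * Real.cos t) + r * Real.sin t * (r * Real.sin t)) * (r * Real.cos t) := by
    intro t
    rw [hN]; simp only [nodeVec]
    rw [tangentVec_dotProduct_equatorDir hc, hν, hw]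
  have hN2 : ∀ t, N t ⬝ᵥ poleDir = r * Real.sin t -
      (x t * (r * Real.cos t) + r * Real.sin t * (r * Real.sin t)) * (r * Real.sin t) := by
    intro t
    rw [hN]; simp only [nodeVec]
    rw [tangentVec_dotProduct_poleDir, hν, hw]
  have hG1 : ∀ t, G t ⬝ᵥ equatorDir c =
      1 - (1 * (r * Real.cos t) + y t * (r * Real.sin t)) * (r * Real.cos t) := by
    intro t
    rw [hG]; simp only [regularVec]
    rw [tangentVec_dotProduct_equatorDir hc, hν]; simp only [hy, hw]
  have hG2 : ∀ t, G t ⬝ᵥ poleDir =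
      y t - (1 * (r * Real.cos t) + y t * (r * Real.sin t)) * (r * Real.sin t) := by
    intro t
    rw [hG]; simp only [regularVec]
    rw [tangentVec_dotProduct_poleDir, hν]; simp only [hy, hw]
  have cpath := continuous_circlePath (c := c) r
  have cK := (continuous_coeffK (f := f) (c := c) (σ := σ)).comp cpath
  have cx : Continuous x := (((continuous_coeffS (f := f)).comp cpath).div cK hK).neg
  have cy : Continuous y := ((((continuous_apply 2).comp cpath).mul
    ((continuous_coeffA (f := f) (c := c)).comp cpath)).div cK hK).neg
  have cN1 : Continuous fun t => N t ⬝ᵥ equatorDir c := by simp only [hN1]; fun_prop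
  have cN2 : Continuous fun t => N t ⬝ᵥ poleDir := by simp only [hN2]; fun_prop
  have cG1 : Continuous fun t => G t ⬝ᵥ equatorDir c := by simp only [hG1]; fun_prop
  have cG2 : Continuous fun t => G t ⬝ᵥ poleDir := by simp only [hG2]; fun_prop
  -- The vertical component of the node vector has the sign of `ω`.
  have posN : ∀ t, ∃ m : ℝ, 0 < m ∧ N t ⬝ᵥ poleDir = Real.sin t * m := by
    intro t
    have h := (near t).node_pos
    rw [hν, hw] at h
    refine ⟨_, mul_pos hr0 h, ?_⟩
    rw [hN2]; simp only [hx]; ring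
  have posG : ∀ t, 0 < G t ⬝ᵥ equatorDir c := by
    intro t
    have h := (near t).regular_pos
    rw [hν, hw] at h
    rw [hG1]; simp only [hy, hw]
    convert h using 1; ring
  have zeroG : ∀ t, Real.sin t = 0 → G t ⬝ᵥ poleDir = 0 := by
    intro t ht
    rw [hG2]; simp only [hy, hw, ht]; simp
  have zeroN : ∀ t, Real.sin t = 0 → N t ⬝ᵥ poleDir = 0 := by
    intro t ht
    rw [hN2, ht]; ring
  -- At the two crossings of the equator the node vector points outward, so it has opposite
  -- directions there.
  have dirN : ∀ t, Real.sin t = 0 → Real.cos t ≠ 0 →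
      0 < (N t ⬝ᵥ equatorDir c) * Real.cos t := by
    intro t ht ht'
    have h := (near t).node_direction hn hc hσ hzero (by rw [hw, ht, mul_zero])
      (by rw [hν]; exact mul_ne_zero hr0.ne' ht')
    rw [hν] at h
    have h3 : 0 < x t * Real.cos t := by
      have : 0 < r * (x t * Real.cos t) := by simp only [hx]; linarith
      exact (mul_pos_iff_of_pos_left hr0).1 this
    have h4 : Real.cos t ^ 2 = 1 := by
      have := Real.sin_sq_add_cos_sq t
      rw [ht] at this; linarith
    rw [hN1, ht]
    have h5 : (x t - (x t * (r * Real.cos t) + r * 0 * (r * 0)) * (r * Real.cos t)) * Real.cos t =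
        x t * Real.cos t * (1 - r ^ 2) := by
      linear_combination -(x t * r ^ 2 * Real.cos t) * h4
    rw [h5]
    exact mul_pos h3 (by linarith)
  have upper : ∀ t ∈ Set.Icc 0 Real.pi, |circlePath c r t 2| = circlePath c r t 2 := by
    intro t ht
    rw [hw]
    exact abs_of_nonneg (mul_nonneg hr0.le (Real.sin_nonneg_of_mem_Icc ht))
  have sin_lower : ∀ t ∈ Set.Icc Real.pi (2 * Real.pi), Real.sin t ≤ 0 := by
    intro t ht
    have := Real.sin_nonneg_of_nonneg_of_le_pi (x := t - Real.pi) (by linarith [ht.1])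
      (by linarith [ht.2])
    rw [Real.sin_sub_pi] at this
    linarith
  have lower : ∀ t ∈ Set.Icc Real.pi (2 * Real.pi),
      |circlePath c r t 2| = -circlePath c r t 2 := by
    intro t ht
    rw [hw]
    exact abs_of_nonpos (mul_nonpos_of_nonneg_of_nonpos hr0.le (sin_lower t ht))
  have hpi := Real.pi_pos
  have hpi2 : Real.pi ≤ 2 * Real.pi := by linarith
  have main : AngleOn (fun t => lineField f k (circlePath c r t)) (equatorDir c) poleDir 0
      (2 * Real.pi) 0 Real.pi := by
    rcases neg_one_pow_eq_or_eq_neg k hσ with hk | hk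
    · have h1 : AngleOn (fun t => lineField f k (circlePath c r t)) (equatorDir c) poleDir 0
          Real.pi 0 Real.pi := by
        refine angleOn_zero_pi (ξ := N) ?_ cN1.continuousOn cN2.continuousOn ?_ (zeroN 0 (by simp))
          (zeroN _ (by simp)) ?_ ?_
        · intro t ht
          exact lineField_eq_span_nodeVec hn hσ (unit t) (near t) (by rw [upper t ht, hk]) (hne t)
        · intro t ht
          obtain ⟨m, hm, h⟩ := posN t
          rw [h]
          exact mul_pos (Real.sin_pos_of_mem_Ioo ht) hm
        · simpa using dirN 0 (by simp) (by simp)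
        · simpa using dirN Real.pi (by simp) (by simp)
      have h2 : AngleOn (fun t => lineField f k (circlePath c r t)) (equatorDir c) poleDir Real.pi
          (2 * Real.pi) 0 0 := by
        refine angleOn_zero_zero (ξ := G) ?_ cG1.continuousOn cG2.continuousOn
          (fun t _ => posG t) (zeroG _ (by simp)) (zeroG _ (by simp))
        intro t ht
        exact lineField_eq_span_regularVec hn hσ (unit t) (near t)
          (by rw [lower t ht, hk]; ring) (hne t)
      -- The first half ends at angle π, so the second is described by the reversed regular vector.
      have h3 := h2.add_pi
      rw [zero_add] at h3
      exact h1.trans hpi.le hpi2 h3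
    · have h1 : AngleOn (fun t => lineField f k (circlePath c r t)) (equatorDir c) poleDir 0
          Real.pi 0 0 := by
        refine angleOn_zero_zero (ξ := G) ?_ cG1.continuousOn cG2.continuousOn
          (fun t _ => posG t) (zeroG _ (by simp)) (zeroG _ (by simp))
        intro t ht
        exact lineField_eq_span_regularVec hn hσ (unit t) (near t)
          (by rw [upper t ht, hk]) (hne t)
      have h2 : AngleOn (fun t => lineField f k (circlePath c r t)) (equatorDir c) poleDir Real.pi
          (2 * Real.pi) 0 Real.pi := by
        -- Below the equator the node vector points down; its negative lies in the upper half plane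
        -- and starts, at `t = π`, along the positive first axis.
        refine angleOn_zero_pi (ξ := fun t => -N t) ?_ ?_ ?_ ?_ ?_ ?_ ?_ ?_
        · intro t ht
          rw [← Set.neg_singleton, Submodule.span_neg]
          exact lineField_eq_span_nodeVec hn hσ (unit t) (near t)
            (by rw [lower t ht, hk]; ring) (hne t)
        · simp only [neg_dotProduct]; exact cN1.neg.continuousOn
        · simp only [neg_dotProduct]; exact cN2.neg.continuousOn
        · intro t ht
          obtain ⟨m, hm, h⟩ := posN t
          rw [neg_dotProduct, h, ← neg_mul]
          refine mul_pos ?_ hm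
          rw [← Real.sin_sub_pi]
          exact Real.sin_pos_of_pos_of_lt_pi (by linarith [ht.1]) (by linarith [ht.2])
        · rw [neg_dotProduct, zeroN _ (by simp), neg_zero]
        · rw [neg_dotProduct, zeroN _ (by simp), neg_zero]
        · simpa using dirN Real.pi (by simp) (by simp)
        · simpa using dirN (2 * Real.pi) (by simp) (by simp)
      exact h1.trans hpi.le hpi2 h2
  obtain ⟨θ, h1, h2, h3, h4⟩ := main
  refine ⟨θ, h1, h2, ?_⟩
  rw [h3, h4]; ring

end Index


/-! ### Index sums -/

/-- A subset of the zeros of the top form on the equator has index sum half its cardinality. -/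
theorem indexSumBetween_of_subset {f : MvPolynomial (Fin 2) ℝ} (hn : 2 ≤ f.totalDegree)
    (hsq : Squarefree (topForm f)) (k : ℕ) {s : Set (Fin 3 → ℝ)}
    (hs : s ⊆ singularPointsAtInfinity f k) {b : ℝ}
    (hb : ((circleZeros (topForm f)).ncard : ℝ) ≤ 2 * b) :
    IndexSumBetween (lineField f k) s 0 b := by
  obtain ⟨m, hm⟩ : ∃ m, f.totalDegree = m + 1 := ⟨f.totalDegree - 1, by omega⟩
  have hhom := topForm_isHomogeneous f
  rw [hm] at hhom
  have hfin := (circleZeros_bound hhom hsq.ne_zero).1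
  have hmem : ∀ p ∈ s, p 2 = 0 ∧ ![p 0, p 1] ∈ circleZeros (topForm f) := by
    intro p hp
    have h1 := hs hp
    have h2 := eval_topForm_eq_zero_of_singular hn h1
    have h3 : p ⬝ᵥ p = 1 := h1.2.1
    have h4 : p 2 = 0 := h1.2.2
    rw [dotProduct_three, h4] at h3
    refine ⟨h4, ?_, h2⟩
    simp; linarith
  have hp3 : ∀ p ∈ s, p = ![p 0, p 1, 0] := by
    intro p hp
    ext i
    fin_cases i
    · rfl
    · rfl
    · exact (hmem p hp).1
  have hsub : s ⊆ (fun z : Fin 2 → ℝ => ![z 0, z 1, 0]) '' circleZeros (topForm f) := by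
    intro p hp
    exact ⟨![p 0, p 1], (hmem p hp).2, (hp3 p hp).symm⟩
  have hsfin : s.Finite := (hfin.image _).subset hsub
  have hcard : s.ncard ≤ (circleZeros (topForm f)).ncard :=
    (Set.ncard_le_ncard hsub (hfin.image _)).trans (Set.ncard_image_le hfin)
  have hsum : ∑ᶠ p ∈ s, (1 / 2 : ℝ) = s.ncard * (1 / 2) := by
    rw [finsum_mem_eq_finite_toFinset_sum _ hsfin, Finset.sum_const, nsmul_eq_mul,
      Set.ncard_eq_toFinset_card s hsfin]
  refine ⟨hsfin, fun _ => 1 / 2, ?_, ?_, ?_⟩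
  · intro p hp
    have := hasPoincareIndex_half hn hsq (hmem p hp).2.1 (hmem p hp).2.2 k
    rw [hp3 p hp]
    exact this
  · rw [hsum]; positivity
  · rw [hsum]
    have : (s.ncard : ℝ) ≤ (circleZeros (topForm f)).ncard := by exact_mod_cast hcard
    linarith

/-- In degree at most one, H_f and its differential vanish identically, so the differential cannot
be independent of that of `z`. -/
theorem two_le_totalDegree_of_transversal {f : MvPolynomial (Fin 2) ℝ}
    (hne : (projHessianCurve f ∩ lineAtInfinity).Nonempty)
    (ht : HessianTransversalAtInfinity f) : 2 ≤ f.totalDegree := by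
  by_contra h
  obtain ⟨P, hP⟩ := hne
  refine (ht P hP).ne_zero 0 ?_
  rw [hessForm_eq_zero (by omega)]
  ext i
  simp

/-- In degree at most one, H_f = 0 and the Hessian curve is the whole plane; it contains (1 : 0 :
0). -/
theorem two_le_totalDegree_of_inter_eq_empty {f : MvPolynomial (Fin 2) ℝ}
    (he : projHessianCurve f ∩ lineAtInfinity = ∅) : 2 ≤ f.totalDegree := by
  by_contra h
  have hv : (![1, 0, 0] : Fin 3 → ℝ) ≠ 0 := fun h0 => one_ne_zero (congrFun h0 0)
  have hmem : Projectivization.mk ℝ (![1, 0, 0] : Fin 3 → ℝ) hv ∈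
      projHessianCurve f ∩ lineAtInfinity := by
    refine ⟨?_, ?_⟩
    · simp [projHessianCurve, hessForm_eq_zero (show f.totalDegree ≤ 1 by omega)]
    · obtain ⟨a, ha⟩ := Projectivization.exists_smul_eq_mk_rep ℝ (![1, 0, 0] : Fin 3 → ℝ) hv
      have := congrFun ha 2
      simp at this
      exact this.symm
  rw [he] at hmem
  exact hmem

/-- H_f restricts to Hess f_n on the line at infinity, so a common point is a nontrivial real zero
of Hess f_n. -/
theorem circleZeros_bound_of_inter_nonempty {f : MvPolynomial (Fin 2) ℝ}
    (hn : 2 ≤ f.totalDegree) (hsq : Squarefree (topForm f))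
    (hne : (projHessianCurve f ∩ lineAtInfinity).Nonempty) :
    ((circleZeros (topForm f)).ncard : ℝ) ≤ 2 * ((f.totalDegree : ℝ) - 2) := by
  obtain ⟨P, hP1, hP2⟩ := hne
  have hP1' : eval P.rep (hessForm f) = 0 := hP1
  have hP2' : P.rep 2 = 0 := hP2
  rw [eval_hessForm_of_eq_zero hn hP2'] at hP1'
  obtain ⟨m, hm⟩ : ∃ m, f.totalDegree = m + 2 := ⟨f.totalDegree - 2, by omega⟩
  have hhom := topForm_isHomogeneous f
  rw [hm] at hhom
  have hq : (![P.rep 0, P.rep 1] : Fin 2 → ℝ) ≠ 0 := by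
    intro h0
    apply P.rep_nonzero
    ext i
    fin_cases i
    · exact congrFun h0 0
    · exact congrFun h0 1
    · exact hP2'
  have := circleZeros_bound_of_hess_eq_zero hhom hsq hq hP1'
  have h2 : ((circleZeros (topForm f)).ncard : ℝ) ≤ 2 * m := by exact_mod_cast this
  rw [hm]; push_cast; linarith

end AsymptoticFields

end

open AsymptoticFields in
theorem mainTheorem8 (f : MvPolynomial (Fin 2) ℝ)
    (hf : Squarefree (AsymptoticFields.topForm f)) (k : ℕ) (hk : k = 1 ∨ k = 2) :
    ((AsymptoticFields.projHessianCurve f ∩ AsymptoticFields.lineAtInfinity).Nonempty →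
      AsymptoticFields.HessianTransversalAtInfinity f →
      AsymptoticFields.IndexSumBetween (AsymptoticFields.lineField f k)
          (AsymptoticFields.singularPointsAtInfinity f k) 0 ((f.totalDegree : ℝ) - 2) ∧
        (AsymptoticFields.NoFlatPoints f →
          AsymptoticFields.IndexSumBetween (AsymptoticFields.lineField f k)
            (AsymptoticFields.singularPoints f k) 0 ((f.totalDegree : ℝ) - 2))) ∧
    (AsymptoticFields.projHessianCurve f ∩ AsymptoticFields.lineAtInfinity = ∅ →
      AsymptoticFields.IndexSumBetween (AsymptoticFields.lineField f k)
          (AsymptoticFields.singularPointsAtInfinity f k) 0 (f.totalDegree : ℝ) ∧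
        (AsymptoticFields.NoFlatPoints f →
          AsymptoticFields.IndexSumBetween (AsymptoticFields.lineField f k)
            (AsymptoticFields.singularPoints f k) 0 (f.totalDegree : ℝ))) := by
  have hall : 2 ≤ f.totalDegree → NoFlatPoints f →
      singularPoints f k ⊆ singularPointsAtInfinity f k := fun hn hflat p hp =>
    ⟨hp, singularPoints_subset_equator hn hflat k hp⟩
  refine ⟨fun hne ht => ?_, fun he => ?_⟩
  · have hn := two_le_totalDegree_of_transversal hne ht
    have hb := circleZeros_bound_of_inter_nonempty hn hf hne
    exact ⟨indexSumBetween_of_subset hn hf k subset_rfl hb,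
      fun hflat => indexSumBetween_of_subset hn hf k (hall hn hflat) hb⟩
  · have hn := two_le_totalDegree_of_inter_eq_empty he
    obtain ⟨m, hm⟩ : ∃ m, f.totalDegree = m + 1 := ⟨f.totalDegree - 1, by omega⟩
    have hhom := topForm_isHomogeneous f
    rw [hm] at hhom
    have hb : ((circleZeros (topForm f)).ncard : ℝ) ≤ 2 * (f.totalDegree : ℝ) := by
      have := (circleZeros_bound hhom hf.ne_zero).2
      rw [hm]; exact_mod_cast this
    exact ⟨indexSumBetween_of_subset hn hf k subset_rfl hb,
      fun hflat => indexSumBetween_of_subset hn hf k (hall hn hflat) hb⟩
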